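/- Let $\Omega\subset\mathbb{R}^2$ be a domain (a connected open set) with $0\in\Omega$ and let $0<T\le\infty$. A function $u$ is called a (classical) solution of the heat equation $u_t=\Delta u$ in an open set $D\subset\mathbb{R}^2\times\mathbb{R}$ if $u$, its first and second order derivatives in $x$ and its first order derivative in $t$ exist and are continuous in $D$, and $u_t=\Delta u$ in $D$. A solution $u$ of the heat equation in $(\Omega\setminus\{0\})\times(0,T)$ is said to have removable singularities at $\{0\}\times(0,T)$ if there is a classical solution $v$ of the heat equation in $\Omega\times(0,T)$ with $u=v$ in $(\Omega\setminus\{0\})\times(0,T)$. Let $u$ be a solution of the heat equation in $(\Omega\setminus\{0\})\times(0,T)$. Then $u$ has removable singularities at $\{0\}\times(0,T)$ if and only if for all $0<t_1<t_2<T$ and $\delta\in(0,1)$ there is a radius $R_0>0$, depending on $t_1$, $t_2$ and $\delta$, such that $\{x:|x|\le R_0\}\subset\Omega$ and $$|u(x,t)|\le\delta\log(1/|x|)\qquad\text{for all } 0<|x|\le R_0,\ t_1\le t\le t_2.$$ The condition is sharp in the following sense: the function $\log|x|$ is a solution of the heat equation in $(\Omega\setminus\{0\})\times(0,T)$ (in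 particular for $\Omega=\mathbb{R}^2$, $T=\infty$), but it does not have removable singularities at $\{0\}\times(0,T)$, and it does not satisfy the condition above. -/

import Mathlib

/-- The time interval `(0, T)`, where `0 < T ≤ ∞`. -/
def timeInterval (T : EReal) : Set ℝ :=
  {t : ℝ | 0 < t ∧ (t : EReal) < T}

/-- `u = u(x, t)` is a classical solution of the heat equation `u_t = Δ u` in the open set
`D` of space-time: `u` is of class `C^{2,1}` in `D`, that is, `u`, its first and second order
derivatives in `x` and its first order derivative in `t` exist and are continuous (jointly in
`(x, t)`) in `D`, and the equation holds at every point of `D`.  Only the values of `u` in `D`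
matter, as `D` is open. -/
structure IsClassicalHeatSolution {n : ℕ} (D : Set (EuclideanSpace ℝ (Fin n) × ℝ))
    (u : EuclideanSpace ℝ (Fin n) → ℝ → ℝ) : Prop where
  contDiffAt_space : ∀ p ∈ D, ContDiffAt ℝ 2 (fun y => u y p.2) p.1
  differentiableAt_time : ∀ p ∈ D, DifferentiableAt ℝ (fun s => u p.1 s) p.2
  continuousOn : ContinuousOn (fun p : EuclideanSpace ℝ (Fin n) × ℝ => u p.1 p.2) D
  continuousOn_fderiv_space :
    ContinuousOn (fun p : EuclideanSpace ℝ (Fin n) × ℝ => fderiv ℝ (fun y => u y p.2) p.1) D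
  continuousOn_iteratedFDeriv_space :
    ContinuousOn
      (fun p : EuclideanSpace ℝ (Fin n) × ℝ => iteratedFDeriv ℝ 2 (fun y => u y p.2) p.1) D
  continuousOn_deriv_time :
    ContinuousOn (fun p : EuclideanSpace ℝ (Fin n) × ℝ => deriv (fun s => u p.1 s) p.2) D
  heat_eq : ∀ p ∈ D,
    deriv (fun s => u p.1 s) p.2 = Laplacian.laplacian (fun y => u y p.2) p.1

/-- `u`, defined in `(Ω ∖ {0}) × (0, T)`, has removable singularities at `{0} × (0, T)`: it
agrees there with a classical solution of the heat equation in `Ω × (0, T)`. -/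
def HasRemovableSingularities {n : ℕ} (Ω : Set (EuclideanSpace ℝ (Fin n))) (T : EReal)
    (u : EuclideanSpace ℝ (Fin n) → ℝ → ℝ) : Prop :=
  ∃ v : EuclideanSpace ℝ (Fin n) → ℝ → ℝ,
    IsClassicalHeatSolution (Ω ×ˢ timeInterval T) v ∧
      ∀ x ∈ Ω \ {0}, ∀ t ∈ timeInterval T, u x t = v x t

/-- For all `0 < t₁ < t₂ < T` and `δ ∈ (0, 1)` there is a closed ball of radius `R₀ > 0` about
the origin, contained in `Ω`, such that `|u(x, t)| ≤ δ log (1 / |x|)` for `0 < |x| ≤ R₀` and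
`t₁ ≤ t ≤ t₂`. -/
def LogGrowthCondition (Ω : Set (EuclideanSpace ℝ (Fin 2))) (T : EReal)
    (u : EuclideanSpace ℝ (Fin 2) → ℝ → ℝ) : Prop :=
  ∀ t₁ t₂ : ℝ, 0 < t₁ → t₁ < t₂ → (t₂ : EReal) < T → ∀ δ : ℝ, 0 < δ → δ < 1 →
    ∃ R₀ : ℝ, 0 < R₀ ∧ Metric.closedBall (0 : EuclideanSpace ℝ (Fin 2)) R₀ ⊆ Ω ∧
      ∀ x : EuclideanSpace ℝ (Fin 2), 0 < ‖x‖ → ‖x‖ ≤ R₀ → ∀ t : ℝ, t₁ ≤ t → t ≤ t₂ →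
        |u x t| ≤ δ * Real.log (1 / ‖x‖)

open Real Set Filter Topology MeasureTheory
open scoped ContDiff InnerProductSpace

/-! The substance is that the growth condition implies removability, and the tool is Green's formula
against the heat kernel with pole `(x, t)`, `x ≠ 0`. For a cutoff `c` supported off the origin and
equal to `1` near `x`, it expresses `4 π u(x, t)` by an integral over an initial time slice and an
integral of `u` against `heatFlux c`, which lives only where `c` varies (`heat_representation`).

Take `c = a + (χ_L - 1)`, with `a` a fixed bump and `χ_L` a function of `log |y| / L` rising from
`0` to `1` for `exp (-2L) ≤ |y| ≤ exp (-L)`. Since `log |y|` is harmonic in the plane, `|∇χ_L| ≲ 1 /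
(L |y|)` and `|Δχ_L| ≲ 1 / (L² |y|²)`. On the annulus the kernel is bounded and `|u| ≤ 2 δ L`, while
`∫ |y|⁻²` over it is proportional to `L`. The inner flux is thus `O(δ)` for large `L`, with `δ`
arbitrary, and disappears as `L → ∞` (`tendsto_integral_mul_heatFlux_logCutoff`).

What remains (`punctured_heat_representation`) is a formula for `u` near the origin whose right side
is smooth in `(x, t)` even at `x = 0`: the initial slice is earlier than `t`, and the flux of `a` is
supported away from the inner ball. This gives local `C²` extensions
(`exists_contDiffOn_extension`). The heat equation passes to the axis by continuity, and the local
extensions agree there as limits of `u`.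

Conversely, an extension is locally bounded, hence below `δ log (1 / |x|)` near `0`. The function
`log |x|` violates the growth condition already for `δ = 1/2`, so it is not removable either. -/

/-- The Euclidean plane. -/
abbrev Plane := EuclideanSpace ℝ (Fin 2)

/-! ### The heat kernel and its smoothness. -/

/-- `τ⁻ᵏ exp (-|z|² / (4 τ))` for `τ > 0`, extended by zero to `τ ≤ 0`.  The case `k = 1` is
`4 π` times the heat kernel of the plane. -/
noncomputable def heatPow (k : ℕ) (z : Plane) (τ : ℝ) : ℝ :=
  if 0 < τ then τ⁻¹ ^ k * exp (-‖z‖ ^ 2 / (4 * τ)) else 0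

lemma heatPow_of_pos (k : ℕ) (z : Plane) {τ : ℝ} (h : 0 < τ) :
    heatPow k z τ = τ⁻¹ ^ k * exp (-‖z‖ ^ 2 / (4 * τ)) := if_pos h

lemma heatPow_of_nonpos (k : ℕ) (z : Plane) {τ : ℝ} (h : τ ≤ 0) : heatPow k z τ = 0 :=
  if_neg h.not_gt

lemma heatPow_nonneg (k : ℕ) (z : Plane) (τ : ℝ) : 0 ≤ heatPow k z τ := by
  unfold heatPow
  split_ifs with h <;> positivity

/-- In the variable `4 τ / |z|²` the kernel is a power of the inverse times `expNegInvGlue`, a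
function known to be smooth across zero. This form gives smoothness across `τ = 0` when `z ≠ 0`. -/
lemma heatPow_eq_expNegInvGlue (k : ℕ) {z : Plane} (hz : z ≠ 0) (τ : ℝ) :
    heatPow k z τ = (4 / ‖z‖ ^ 2) ^ k *
      ((Polynomial.X ^ k : Polynomial ℝ).eval (4 * τ / ‖z‖ ^ 2)⁻¹ *
        expNegInvGlue (4 * τ / ‖z‖ ^ 2)) := by
  have hz' : 0 < ‖z‖ := norm_pos_iff.2 hz
  rcases le_or_gt τ 0 with h | h
  · rw [heatPow_of_nonpos k z h, expNegInvGlue.zero_of_nonpos]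
    · simp
    · exact div_nonpos_of_nonpos_of_nonneg (by linarith) (by positivity)
  · rw [heatPow_of_pos k z h, expNegInvGlue, if_neg (not_le.2 (by positivity)), Polynomial.eval_pow,
      Polynomial.eval_X, ← mul_assoc, ← mul_pow]
    congr 2 <;> field_simp

/-- Off `z = 0` the glue-function form applies at every time; for `τ > 0` the explicit formula does.
Only the half-line `z = 0`, `τ ≤ 0` is excluded. -/
lemma contDiffAt_heatPow (k : ℕ) {n : ℕ∞} {p : Plane × ℝ} (hp : p.1 ≠ 0 ∨ 0 < p.2) :
    ContDiffAt ℝ n (fun q : Plane × ℝ => heatPow k q.1 q.2) p := by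
  rcases hp with hp | hp
  · have h1 : (fun q : Plane × ℝ => heatPow k q.1 q.2) =ᶠ[𝓝 p] fun q => (4 / ‖q.1‖ ^ 2) ^ k *
        ((Polynomial.X ^ k : Polynomial ℝ).eval (4 * q.2 / ‖q.1‖ ^ 2)⁻¹ *
        expNegInvGlue (4 * q.2 / ‖q.1‖ ^ 2)) := by
      have : ∀ᶠ q : Plane × ℝ in 𝓝 p, q.1 ≠ 0 :=
        continuous_fst.continuousAt.eventually_ne hp
      filter_upwards [this] with q hq using heatPow_eq_expNegInvGlue k hq q.2
    refine ContDiffAt.congr_of_eventuallyEq ?_ h1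
    have hn : ContDiffAt ℝ n (fun q : Plane × ℝ => ‖q.1‖ ^ 2) p :=
      (contDiff_norm_sq ℝ).contDiffAt.comp p contDiffAt_fst
    have hne : ‖p.1‖ ^ 2 ≠ 0 := by simpa using hp
    refine ContDiffAt.mul ((contDiffAt_const.div hn hne).pow k) ?_
    exact (expNegInvGlue.contDiff_polynomial_eval_inv_mul
      (Polynomial.X ^ k : Polynomial ℝ)).contDiffAt.comp p
      ((contDiffAt_const.mul contDiffAt_snd).div hn hne)
  · have h1 : (fun q : Plane × ℝ => heatPow k q.1 q.2) =ᶠ[𝓝 p]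
        fun q => q.2⁻¹ ^ k * exp (-‖q.1‖ ^ 2 / (4 * q.2)) := by
      have : ∀ᶠ q : Plane × ℝ in 𝓝 p, 0 < q.2 :=
        continuous_snd.continuousAt.eventually (lt_mem_nhds hp)
      filter_upwards [this] with q hq using heatPow_of_pos k q.1 hq
    refine ContDiffAt.congr_of_eventuallyEq ?_ h1
    have hn : ContDiffAt ℝ n (fun q : Plane × ℝ => ‖q.1‖ ^ 2) p :=
      (contDiff_norm_sq ℝ).contDiffAt.comp p contDiffAt_fst
    exact ((contDiffAt_snd.inv hp.ne').pow k).mul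
      ((hn.neg.div (contDiffAt_const.mul contDiffAt_snd) (by positivity)).exp)

/-! ### Laplacian calculus and Green's second identity. -/

lemma laplacian_eq_sum_fderiv_fderiv (f : Plane → ℝ) (x : Plane) :
    Laplacian.laplacian f x = ∑ i, fderiv ℝ (fderiv ℝ f) x (EuclideanSpace.basisFun (Fin 2) ℝ i)
      (EuclideanSpace.basisFun (Fin 2) ℝ i) := by
  rw [InnerProductSpace.laplacian_eq_iteratedFDeriv_orthonormalBasis f
    (EuclideanSpace.basisFun (Fin 2) ℝ)]
  simp [iteratedFDeriv_two_apply]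

lemma sum_inner_basisFun_mul_self (v : Plane) :
    ∑ i, inner ℝ v (EuclideanSpace.basisFun (Fin 2) ℝ i) *
      inner ℝ v (EuclideanSpace.basisFun (Fin 2) ℝ i) = ‖v‖ ^ 2 := by
  rw [EuclideanSpace.real_norm_sq_eq]
  simp [EuclideanSpace.inner_single_right, pow_two]

lemma sum_clm_mul_inner_basisFun (A : Plane →L[ℝ] ℝ) (v : Plane) :
    ∑ i, A (EuclideanSpace.basisFun (Fin 2) ℝ i) *
      inner ℝ v (EuclideanSpace.basisFun (Fin 2) ℝ i) = A v := by
  conv_rhs => rw [← (EuclideanSpace.basisFun (Fin 2) ℝ).sum_repr v]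
  simp [EuclideanSpace.inner_single_right, mul_comm]

lemma hasFDerivAt_comp_norm_sub_sq {h : ℝ → ℝ} {h' : ℝ} {c y : Plane}
    (hh : HasDerivAt h h' (‖y - c‖ ^ 2)) :
    HasFDerivAt (fun y : Plane => h (‖y - c‖ ^ 2)) ((2 * h') • innerSL ℝ (y - c)) y := by
  have h1 : HasFDerivAt (fun y : Plane => ‖y - c‖ ^ 2) (2 • innerSL ℝ (y - c)) y := by
    simpa using ((hasFDerivAt_id y).sub_const c).norm_sq
  have h2 := hh.comp_hasFDerivAt y h1
  refine h2.congr_fderiv ?_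
  ext v
  simp
  ring

/-- The Laplacian of a function of the squared distance to a point of the plane. -/
lemma laplacian_comp_norm_sub_sq {h h₁ : ℝ → ℝ} {h₂ : ℝ} {c y : Plane}
    (hh : ∀ᶠ r in 𝓝 (‖y - c‖ ^ 2), HasDerivAt h (h₁ r) r)
    (hh₁ : HasDerivAt h₁ h₂ (‖y - c‖ ^ 2)) :
    Laplacian.laplacian (fun y : Plane => h (‖y - c‖ ^ 2)) y =
      4 * h₁ (‖y - c‖ ^ 2) + 4 * ‖y - c‖ ^ 2 * h₂ := by
  have hc : ContinuousAt (fun y : Plane => ‖y - c‖ ^ 2) y := by fun_prop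
  have h1 : fderiv ℝ (fun y : Plane => h (‖y - c‖ ^ 2)) =ᶠ[𝓝 y]
      fun y => (2 * h₁ (‖y - c‖ ^ 2)) • innerSL ℝ (y - c) := by
    filter_upwards [hc.eventually hh] with z hz using (hasFDerivAt_comp_norm_sub_sq hz).fderiv
  have h2 : HasFDerivAt (fun y : Plane => 2 * h₁ (‖y - c‖ ^ 2))
      ((2 : ℝ) • ((2 * h₂) • innerSL ℝ (y - c))) y :=
    (hasFDerivAt_comp_norm_sub_sq hh₁).const_mul 2
  have h3 : HasFDerivAt (fun y : Plane => innerSL ℝ (y - c)) (innerSL ℝ : Plane →L[ℝ] _) y :=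
    (innerSL ℝ : Plane →L[ℝ] Plane →L[ℝ] ℝ).hasFDerivAt.comp y
      ((hasFDerivAt_id y).sub_const c)
  have h4 : HasFDerivAt (fun y : Plane => (2 * h₁ (‖y - c‖ ^ 2)) • innerSL ℝ (y - c)) _ y :=
    h2.smul h3
  rw [laplacian_eq_sum_fderiv_fderiv, h1.fderiv_eq, h4.fderiv]
  have := sum_inner_basisFun_mul_self (y - c)
  simp only [Fin.sum_univ_two] at this ⊢
  simp only [add_apply, smul_apply,
    ContinuousLinearMap.smulRight_apply, innerSL_apply_apply, smul_eq_mul]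
  have e0 : ∀ i, (innerSL ℝ : Plane →L[ℝ] Plane →L[ℝ] ℝ) (EuclideanSpace.basisFun (Fin 2) ℝ i)
      (EuclideanSpace.basisFun (Fin 2) ℝ i) = 1 := fun i => by
    change inner ℝ (EuclideanSpace.basisFun (Fin 2) ℝ i) _ = 1
    rw [real_inner_self_eq_norm_sq, (EuclideanSpace.basisFun (Fin 2) ℝ).norm_eq_one, one_pow]
  rw [e0, e0]
  linear_combination (4 * h₂) * this

/-- The Leibniz rule for the Laplacian. -/
lemma laplacian_mul {f g : Plane → ℝ} {x : Plane} (hf : ContDiffAt ℝ 2 f x)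
    (hg : ContDiffAt ℝ 2 g x) :
    Laplacian.laplacian (fun y => f y * g y) x = f x * Laplacian.laplacian g x +
      2 * ∑ i, fderiv ℝ f x (EuclideanSpace.basisFun (Fin 2) ℝ i) *
        fderiv ℝ g x (EuclideanSpace.basisFun (Fin 2) ℝ i) + g x * Laplacian.laplacian f x := by
  have key : fderiv ℝ (fun y => f y * g y) =ᶠ[𝓝 x]
      fun y => f y • fderiv ℝ g y + g y • fderiv ℝ f y := by
    filter_upwards [hf.eventually (by simp), hg.eventually (by simp)] with y h1 h2
    exact fderiv_fun_mul (h1.differentiableAt (by simp)) (h2.differentiableAt (by simp))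
  have hf1 := hf.differentiableAt (by simp)
  have hg1 := hg.differentiableAt (by simp)
  have hf2 : DifferentiableAt ℝ (fderiv ℝ f) x :=
    (hf.fderiv_right (m := 1) (by norm_num)).differentiableAt (by simp)
  have hg2 : DifferentiableAt ℝ (fderiv ℝ g) x :=
    (hg.fderiv_right (m := 1) (by norm_num)).differentiableAt (by simp)
  have h4 : HasFDerivAt (fun y => f y • fderiv ℝ g y + g y • fderiv ℝ f y) _ x :=
    (hf1.hasFDerivAt.smul hg2.hasFDerivAt).add (hg1.hasFDerivAt.smul hf2.hasFDerivAt)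
  rw [laplacian_eq_sum_fderiv_fderiv, key.fderiv_eq, h4.fderiv,
    laplacian_eq_sum_fderiv_fderiv, laplacian_eq_sum_fderiv_fderiv]
  simp only [Fin.sum_univ_two, add_apply, smul_apply,
    ContinuousLinearMap.smulRight_apply, smul_eq_mul]
  ring

/-- Green's second identity for a compactly supported test function. -/
lemma integral_mul_laplacian_comm {Ω : Set Plane} (hΩ : IsOpen Ω) {U φ : Plane → ℝ}
    (hU : ContDiffOn ℝ 2 U Ω) (hφ : ContDiff ℝ 2 φ) (hc : HasCompactSupport φ)
    (hs : tsupport φ ⊆ Ω) :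
    ∫ y, φ y * Laplacian.laplacian U y = ∫ y, U y * Laplacian.laplacian φ y := by
  have hU' : ∀ x ∈ Ω, ContDiffAt ℝ 2 U x := fun x hx => hU.contDiffAt (hΩ.mem_nhds hx)
  have hU1 : ∀ x ∈ Ω, ContDiffAt ℝ 1 (fderiv ℝ U) x :=
    fun x hx => (hU' x hx).fderiv_right (by norm_num)
  have hU2 : ∀ x ∈ Ω, ContDiffAt ℝ 0 (fderiv ℝ (fderiv ℝ U)) x :=
    fun x hx => (hU1 x hx).fderiv_right (by norm_num)
  have hφ1 : ContDiff ℝ 1 (fderiv ℝ φ) := hφ.fderiv_right (by norm_num)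
  have hφ2 : ContDiff ℝ 0 (fderiv ℝ (fderiv ℝ φ)) := hφ1.fderiv_right (by norm_num)
  have hs1 : tsupport (fderiv ℝ φ) ⊆ tsupport φ := tsupport_fderiv_subset ℝ
  have hs2 : tsupport (fderiv ℝ (fderiv ℝ φ)) ⊆ tsupport φ :=
    (tsupport_fderiv_subset ℝ).trans hs1
  -- `F` is controlled only on `Ω`, but the product vanishes off the support of `G`, which lies in
  -- `Ω`, so it is continuous everywhere with compact support.
  have cont : ∀ {F G : Plane → ℝ}, (∀ x ∈ Ω, ContinuousAt F x) → Continuous G →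
      tsupport G ⊆ tsupport φ → Integrable (fun x => F x * G x) := by
    intro F G hF hG hGs
    have hsub : tsupport (fun x => F x * G x) ⊆ tsupport G :=
      closure_mono (Function.support_mul_subset_right F G)
    refine Continuous.integrable_of_hasCompactSupport ?_
      (hc.of_isClosed_subset (isClosed_tsupport _) (hsub.trans hGs))
    refine continuous_of_tsupport fun x hx => ?_
    exact (hF x (hs (hGs (hsub hx)))).mul hG.continuousAt
  have app_supp : ∀ {F : Plane → Plane →L[ℝ] ℝ} (v : Plane),
      tsupport (fun x => F x v) ⊆ tsupport F := by
    intro F v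
    refine closure_mono fun x hx => ?_
    simp only [Function.mem_support] at hx ⊢
    intro h
    simp [h] at hx
  have app_supp2 : ∀ {F : Plane → Plane →L[ℝ] Plane →L[ℝ] ℝ} (v : Plane),
      tsupport (fun x => F x v v) ⊆ tsupport F := by
    intro F v
    refine closure_mono fun x hx => ?_
    simp only [Function.mem_support] at hx ⊢
    intro h
    simp [h] at hx
  -- Integration by parts twice in the direction `v`. Compact support of `φ` removes boundary terms
  -- and makes the values of `U` and its derivatives outside `Ω` irrelevant.
  have key : ∀ v : Plane, ∫ y, φ y * fderiv ℝ (fderiv ℝ U) y v v =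
      ∫ y, U y * fderiv ℝ (fderiv ℝ φ) y v v := by
    intro v
    have c0 : ∀ x ∈ Ω, ContinuousAt U x := fun x hx => (hU' x hx).continuousAt
    have c1 : ∀ x ∈ Ω, ContinuousAt (fun x => fderiv ℝ U x v) x :=
      fun x hx => (hU1 x hx).continuousAt.clm_apply continuousAt_const
    have c2 : ∀ x ∈ Ω, ContinuousAt (fun x => fderiv ℝ (fderiv ℝ U) x v v) x :=
      fun x hx => ((hU2 x hx).continuousAt.clm_apply continuousAt_const).clm_apply
        continuousAt_const
    have d1 : Continuous (fun x => fderiv ℝ φ x v) := hφ1.continuous.clm_apply continuous_const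
    have d2 : Continuous (fun x => fderiv ℝ (fderiv ℝ φ) x v v) :=
      (hφ2.continuous.clm_apply continuous_const).clm_apply continuous_const
    have f1 : ∀ x ∈ Ω, fderiv ℝ (fun x => fderiv ℝ U x v) x v = fderiv ℝ (fderiv ℝ U) x v v := by
      intro x hx
      rw [fderiv_clm_apply ((hU1 x hx).differentiableAt (by simp)) (differentiableAt_const v)]
      simp
    have f2 : ∀ x, fderiv ℝ (fun x => fderiv ℝ φ x v) x v = fderiv ℝ (fderiv ℝ φ) x v v := by
      intro x
      rw [fderiv_clm_apply (hφ1.contDiffAt.differentiableAt (by simp)) (differentiableAt_const v)]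
      simp
    have s1 : tsupport (fun x => fderiv ℝ φ x v) ⊆ tsupport φ := (app_supp v).trans hs1
    have s2 : tsupport (fun x => fderiv ℝ (fderiv ℝ φ) x v v) ⊆ tsupport φ :=
      (app_supp2 v).trans hs2
    have ibp1 : ∫ y, φ y * fderiv ℝ (fun x => fderiv ℝ U x v) y v =
        -∫ y, fderiv ℝ φ y v * fderiv ℝ U y v := by
      apply integral_mul_fderiv_eq_neg_fderiv_mul_of_integrable
      · simpa only [mul_comm] using cont c1 d1 s1
      · refine Integrable.congr (cont c2 hφ.continuous le_rfl) (ae_of_all _ fun y => ?_)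
        by_cases hy : y ∈ tsupport φ
        · simp only [f1 y (hs hy), mul_comm]
        · simp [image_eq_zero_of_notMem_tsupport hy]
      · simpa only [mul_comm] using cont c1 hφ.continuous le_rfl
      · exact fun x _ => hφ.contDiffAt.differentiableAt (by simp)
      · exact fun x hx => ((hU1 x (hs hx)).differentiableAt (by simp)).clm_apply
          (differentiableAt_const v)
    have ibp2 : ∫ y, U y * fderiv ℝ (fun x => fderiv ℝ φ x v) y v =
        -∫ y, fderiv ℝ U y v * fderiv ℝ φ y v := by
      apply integral_mul_fderiv_eq_neg_fderiv_mul_of_integrable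
      · exact cont c1 d1 s1
      · simpa only [f2] using cont c0 d2 s2
      · exact cont c0 d1 s1
      · exact fun x hx => (hU' x (hs (s1 hx))).differentiableAt (by simp)
      · exact fun x hx => (hφ1.contDiffAt.differentiableAt (by simp)).clm_apply
          (differentiableAt_const v)
    simp only [f2] at ibp2
    rw [ibp2]
    refine Eq.trans (integral_congr_ae (ae_of_all _ fun y => ?_)) (ibp1.trans ?_)
    · by_cases hy : y ∈ tsupport φ
      · simp only [f1 y (hs hy)]
      · simp [image_eq_zero_of_notMem_tsupport hy]
    · simp only [mul_comm]
  have i1 : ∀ v : Plane, Integrable (fun y => φ y * fderiv ℝ (fderiv ℝ U) y v v) := fun v => by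
    simpa only [mul_comm] using cont (fun x hx => ((hU2 x hx).continuousAt.clm_apply
      continuousAt_const).clm_apply continuousAt_const) hφ.continuous le_rfl
  have i2 : ∀ v : Plane, Integrable (fun y => U y * fderiv ℝ (fderiv ℝ φ) y v v) := fun v =>
    cont (fun x hx => (hU' x hx).continuousAt) ((hφ2.continuous.clm_apply
      continuous_const).clm_apply continuous_const) ((app_supp2 v).trans hs2)
  simp only [laplacian_eq_sum_fderiv_fderiv, Finset.mul_sum]
  rw [integral_finsetSum _ fun i _ => i1 _, integral_finsetSum _ fun i _ => i2 _]
  exact Finset.sum_congr rfl fun i _ => key _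

/-! ### Derivatives of the kernel and the flux of a cutoff. -/

/-- The spatial derivative of `heatPow`. -/
lemma hasFDerivAt_heatPow_sub (k : ℕ) (x y : Plane) (τ : ℝ) :
    HasFDerivAt (fun y => heatPow k (x - y) τ)
      ((heatPow (k + 1) (x - y) τ / 2) • innerSL ℝ (x - y)) y := by
  rcases le_or_gt τ 0 with h | h
  · simpa only [heatPow_of_nonpos _ _ h, zero_div, zero_smul] using hasFDerivAt_const (0 : ℝ) y
  · have hd : HasDerivAt (fun r : ℝ => τ⁻¹ ^ k * exp (-r / (4 * τ)))
        (τ⁻¹ ^ k * (exp (-‖y - x‖ ^ 2 / (4 * τ)) * (-1 / (4 * τ)))) (‖y - x‖ ^ 2) :=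
      ((((hasDerivAt_id _).neg).div_const (4 * τ)).exp).const_mul _
    have := hasFDerivAt_comp_norm_sub_sq hd
    simp only [heatPow_of_pos _ _ h, norm_sub_rev x]
    refine this.congr_fderiv ?_
    rw [← neg_sub y x, map_neg, smul_neg, ← neg_smul]
    congr 1
    rw [pow_succ τ⁻¹ k]
    generalize τ⁻¹ ^ k = a
    field_simp
    ring

/-- The Laplacian of `heatPow 1` is its time derivative. -/
lemma laplacian_heatPow_sub (x y : Plane) {τ : ℝ} (h : 0 < τ) :
    Laplacian.laplacian (fun y => heatPow 1 (x - y) τ) y =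
      ‖x - y‖ ^ 2 / 4 * heatPow 3 (x - y) τ - heatPow 2 (x - y) τ := by
  have hd : ∀ r, HasDerivAt (fun r : ℝ => τ⁻¹ ^ 1 * exp (-r / (4 * τ)))
      (τ⁻¹ ^ 1 * (exp (-r / (4 * τ)) * (-1 / (4 * τ)))) r := fun r =>
    ((((hasDerivAt_id _).neg).div_const (4 * τ)).exp).const_mul _
  have hd2 : HasDerivAt (fun r : ℝ => τ⁻¹ ^ 1 * (exp (-r / (4 * τ)) * (-1 / (4 * τ))))
      (τ⁻¹ ^ 1 * (exp (-‖y - x‖ ^ 2 / (4 * τ)) * (-1 / (4 * τ)) * (-1 / (4 * τ))))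
      (‖y - x‖ ^ 2) :=
    (((((hasDerivAt_id _).neg).div_const (4 * τ)).exp).mul_const _).const_mul _
  have := laplacian_comp_norm_sub_sq (c := x) (y := y) (Eventually.of_forall hd) hd2
  simp only [heatPow_of_pos _ _ h, norm_sub_rev x]
  rw [this]
  field_simp
  ring

/-- The time derivative of `heatPow 1`. -/
lemma hasDerivAt_heatPow (z : Plane) {τ : ℝ} (h : 0 < τ) :
    HasDerivAt (fun τ => heatPow 1 z τ) (‖z‖ ^ 2 / 4 * heatPow 3 z τ - heatPow 2 z τ) τ := by
  have h1 : (fun τ => heatPow 1 z τ) =ᶠ[𝓝 τ] fun τ => τ⁻¹ ^ 1 * exp (-‖z‖ ^ 2 / (4 * τ)) := by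
    filter_upwards [lt_mem_nhds h] with t ht using heatPow_of_pos 1 z ht
  refine HasDerivAt.congr_of_eventuallyEq ?_ h1
  have h2 := ((hasDerivAt_inv h.ne').pow 1).mul
    (((hasDerivAt_const τ (-‖z‖ ^ 2)).div ((hasDerivAt_id τ).const_mul 4) (by simpa using h.ne')).exp)
  refine h2.congr_deriv ?_
  simp only [heatPow_of_pos _ _ h]
  simp
  field_simp
  ring

lemma integrable_prod_of_continuousOn {F : Plane → ℝ → ℝ} {K : Set Plane} (hK : IsCompact K)
    {a b : ℝ} (hF : ContinuousOn (fun q : Plane × ℝ => F q.1 q.2) (K ×ˢ Icc a b))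
    (h0 : ∀ y ∉ K, ∀ s ∈ Icc a b, F y s = 0) :
    Integrable (fun q : ℝ × Plane => F q.2 q.1) ((volume.restrict (Icc a b)).prod volume) := by
  have hm : (volume.restrict (Icc a b)).prod (volume : Measure Plane) =
      (volume.prod volume).restrict (Icc a b ×ˢ univ) := by
    rw [← Measure.prod_restrict, Measure.restrict_univ]
  rw [hm]
  have h1 : IntegrableOn (fun q : ℝ × Plane => F q.2 q.1) (Icc a b ×ˢ K) (volume.prod volume) := by
    refine ContinuousOn.integrableOn_compact (isCompact_Icc.prod hK) ?_
    exact hF.comp continuous_swap.continuousOn fun q hq => ⟨hq.2, hq.1⟩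
  refine h1.of_forall_sdiff_eq_zero (measurableSet_Icc.prod MeasurableSet.univ) ?_
  rintro ⟨s, y⟩ ⟨⟨hs, -⟩, h⟩
  exact h0 y (fun hy => h ⟨hs, hy⟩) s hs

lemma integrable_of_continuousOn_of_eq_zero {f : Plane → ℝ} {K : Set Plane} (hK : IsCompact K)
    (hf : ContinuousOn f K) (h0 : ∀ y ∉ K, f y = 0) : Integrable f :=
  (hf.integrableOn_compact hK).integrable_of_forall_notMem_eq_zero h0

/-- The source term produced by cutting off the heat kernel with pole `(x, t)` by a function `c` of
the space variable. -/
noncomputable def heatFlux (c : Plane → ℝ) (x : Plane) (t : ℝ) (y : Plane) (s : ℝ) : ℝ :=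
  fderiv ℝ c y (x - y) * heatPow 2 (x - y) (t - s) +
    Laplacian.laplacian c y * heatPow 1 (x - y) (t - s)

lemma contDiff_heatPow_sub (k : ℕ) (x : Plane) {τ : ℝ} (h : 0 < τ) {n : ℕ∞} :
    ContDiff ℝ n (fun y => heatPow k (x - y) τ) := by
  rw [contDiff_iff_contDiffAt]
  intro y
  have := contDiffAt_heatPow k (n := n) (p := (x - y, τ)) (Or.inr h)
  exact ContDiffAt.comp (f := fun y => (x - y, τ)) y this
    ((contDiffAt_const.sub contDiffAt_id).prodMk contDiffAt_const)

/-- In the Leibniz rule the cross term `2 ∇c · ∇P` loses its factor `2` to the `1/2` in `∇P = (x -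
y) heatPow 2 / 2`. Hence `heatFlux` is the commutator of `Δ` with multiplication by `c`, applied to
the kernel. -/
lemma laplacian_mul_heatPow {c : Plane → ℝ} (hc : ContDiff ℝ 2 c) (x y : Plane) {t s : ℝ}
    (h : s < t) :
    Laplacian.laplacian (fun y => c y * heatPow 1 (x - y) (t - s)) y =
      c y * (‖x - y‖ ^ 2 / 4 * heatPow 3 (x - y) (t - s) - heatPow 2 (x - y) (t - s)) +
        heatFlux c x t y s := by
  rw [laplacian_mul hc.contDiffAt (contDiff_heatPow_sub 1 x (sub_pos.2 h) (n := 2)).contDiffAt,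
    laplacian_heatPow_sub x y (sub_pos.2 h), (hasFDerivAt_heatPow_sub 1 x y (t - s)).fderiv,
    heatFlux, ← sum_clm_mul_inner_basisFun (fderiv ℝ c y) (x - y)]
  simp only [Fin.sum_univ_two, smul_apply, innerSL_apply_apply, smul_eq_mul]
  ring

lemma continuous_laplacian {c : Plane → ℝ} (hc : ContDiff ℝ 2 c) :
    Continuous (Laplacian.laplacian c) := by
  have h2 : Continuous (fderiv ℝ (fderiv ℝ c)) :=
    ((hc.fderiv_right (m := 1) (by norm_num)).fderiv_right (m := 0) (by norm_num)).continuous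
  have : Laplacian.laplacian c = fun x =>
      ∑ i, fderiv ℝ (fderiv ℝ c) x (EuclideanSpace.basisFun (Fin 2) ℝ i)
      (EuclideanSpace.basisFun (Fin 2) ℝ i) := funext (laplacian_eq_sum_fderiv_fderiv c)
  rw [this]
  exact continuous_finsetSum _ fun i _ => (h2.clm_apply continuous_const).clm_apply continuous_const

lemma continuousAt_heatPow_sub (k : ℕ) {x y : Plane} {t s : ℝ} (h : x ≠ y ∨ s < t) :
    ContinuousAt (fun q : Plane × ℝ => heatPow k (x - q.1) (t - q.2)) (y, s) := by
  have h1 : ContinuousAt (fun q : Plane × ℝ => heatPow k q.1 q.2) (x - y, t - s) :=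
    (contDiffAt_heatPow k (n := 0) (h.imp sub_ne_zero.2 sub_pos.2)).continuousAt
  exact ContinuousAt.comp (f := fun q : Plane × ℝ => (x - q.1, t - q.2)) (x := (y, s)) h1
    (by fun_prop)

lemma continuousAt_heatFlux {c : Plane → ℝ} (hc : ContDiff ℝ 2 c) {x y : Plane} {t s : ℝ}
    (h : x ≠ y ∨ s < t) :
    ContinuousAt (fun q : Plane × ℝ => heatFlux c x t q.1 q.2) (y, s) := by
  unfold heatFlux
  have h1 : Continuous fun q : Plane × ℝ => fderiv ℝ c q.1 (x - q.1) :=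
    ((hc.continuous_fderiv (by simp)).comp continuous_fst).clm_apply
      (continuous_const.sub continuous_fst)
  exact (h1.continuousAt.mul (continuousAt_heatPow_sub 2 h)).add
    (((continuous_laplacian hc).comp continuous_fst).continuousAt.mul (continuousAt_heatPow_sub 1 h))

/-- The flux involves only derivatives of `c`, so it is localized where the cutoff varies. -/
lemma heatFlux_eq_zero_of_eventuallyEq {c : Plane → ℝ} {y : Plane} {a : ℝ}
    (h : c =ᶠ[𝓝 y] fun _ => a) (x : Plane) (t s : ℝ) : heatFlux c x t y s = 0 := by
  have h1 : fderiv ℝ c y = 0 := by rw [h.fderiv_eq]; simp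
  have h2 : Laplacian.laplacian c y = 0 := by
    rw [(InnerProductSpace.laplacian_congr_nhds h).eq_of_nhds]
    have := InnerProductSpace.laplacian_const (E := Plane) (c := a)
    exact congrFun this y
  simp [heatFlux, h1, h2]

lemma heatFlux_eq_zero_of_notMem_tsupport {c : Plane → ℝ} {y : Plane} (h : y ∉ tsupport c)
    (x : Plane) (t s : ℝ) : heatFlux c x t y s = 0 :=
  heatFlux_eq_zero_of_eventuallyEq (notMem_tsupport_iff_eventuallyEq.1 h) x t s

/-- Local constancy of `c` at `x` kills the flux near the kernel's singularity; elsewhere the kernel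
is continuous for all `s`, including `s ≥ t`. -/
lemma continuous_heatFlux {c : Plane → ℝ} (hc : ContDiff ℝ 2 c) {x : Plane} {a : ℝ}
    (h : c =ᶠ[𝓝 x] fun _ => a) (t : ℝ) :
    Continuous (fun q : Plane × ℝ => heatFlux c x t q.1 q.2) := by
  rw [continuous_iff_continuousAt]
  rintro ⟨y, s⟩
  by_cases hy : x = y
  · subst hy
    have : (fun q : Plane × ℝ => heatFlux c x t q.1 q.2) =ᶠ[𝓝 (x, s)] fun _ => 0 := by
      have h' : ∀ᶠ y in 𝓝 x, c =ᶠ[𝓝 y] fun _ => a := h.eventually_nhds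
      filter_upwards [continuousAt_fst.eventually h'] with q hq
      exact heatFlux_eq_zero_of_eventuallyEq hq x t q.2
    exact continuousAt_const.congr this.symm
  · exact continuousAt_heatFlux hc (Or.inl hy)

/-! ### Green's formula and the representation of solutions. -/

section Green

variable {Ω : Set Plane} {I : Set ℝ} {u : Plane → ℝ → ℝ} {c : Plane → ℝ}

lemma IsClassicalHeatSolution.contDiffOn_slice (hu : IsClassicalHeatSolution (Ω ×ˢ I) u) {s : ℝ}
    (hs : s ∈ I) : ContDiffOn ℝ 2 (fun y => u y s) Ω :=
  fun y hy => (hu.contDiffAt_space (y, s) ⟨hy, hs⟩).contDiffWithinAt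

/-- Green's formula for the heat equation on `Plane × [s₁, s₂]`, tested against the heat kernel
with pole `(x, t)` after `s₂`, cut off in space. -/
lemma integral_mul_heatPow_sub_eq (hΩ : IsOpen Ω)
    (hu : IsClassicalHeatSolution (Ω ×ˢ I) u) (hc : ContDiff ℝ 2 c) (hcs : HasCompactSupport c)
    (hcΩ : tsupport c ⊆ Ω) (x : Plane) {s₁ s₂ t : ℝ} (h12 : s₁ ≤ s₂) (h2 : s₂ < t)
    (hI : Icc s₁ s₂ ⊆ I) :
    (∫ y, u y s₂ * c y * heatPow 1 (x - y) (t - s₂)) -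
      (∫ y, u y s₁ * c y * heatPow 1 (x - y) (t - s₁)) =
      ∫ s in s₁..s₂, ∫ y, u y s * heatFlux c x t y s := by
  set dK : Plane → ℝ → ℝ := fun y s =>
    ‖x - y‖ ^ 2 / 4 * heatPow 3 (x - y) (t - s) - heatPow 2 (x - y) (t - s) with hdK
  -- `dK` is `∂_τ` of the kernel at `τ = t - s`, equal to its Laplacian, so `A` is `∂_s (u c P)`.
  -- Integrating `A` first in `s` gives the two time slices; integrating it first in `y` and using
  -- Green's identity gives the flux, as the terms with `dK` cancel.
  set A : Plane → ℝ → ℝ := fun y s =>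
    deriv (fun s => u y s) s * (c y * heatPow 1 (x - y) (t - s)) - u y s * (c y * dK y s) with hA
  have hlt : ∀ s ∈ Icc s₁ s₂, s < t := fun s hs => hs.2.trans_lt h2
  have h0 : ∀ y ∉ tsupport c, c y = 0 := fun y hy => image_eq_zero_of_notMem_tsupport hy
  have hsub : tsupport c ×ˢ Icc s₁ s₂ ⊆ Ω ×ˢ I := prod_mono hcΩ hI
  have hPc : ∀ k, ContinuousOn (fun q : Plane × ℝ => heatPow k (x - q.1) (t - q.2))
      (tsupport c ×ˢ Icc s₁ s₂) := fun k q hq =>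
    (continuousAt_heatPow_sub k (Or.inr (hlt q.2 hq.2))).continuousWithinAt
  have hcc : ContinuousOn (fun q : Plane × ℝ => c q.1) (tsupport c ×ˢ Icc s₁ s₂) :=
    (hc.continuous.comp continuous_fst).continuousOn
  have hdKc : ContinuousOn (fun q : Plane × ℝ => dK q.1 q.2) (tsupport c ×ˢ Icc s₁ s₂) := by
    refine ((Continuous.continuousOn ?_).mul (hPc 3)).sub (hPc 2)
    fun_prop
  have hAc : ContinuousOn (fun q : Plane × ℝ => A q.1 q.2) (tsupport c ×ˢ Icc s₁ s₂) :=
    ((hu.continuousOn_deriv_time.mono hsub).mul (hcc.mul (hPc 1))).sub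
      ((hu.continuousOn.mono hsub).mul (hcc.mul hdKc))
  have hA0 : ∀ y ∉ tsupport c, ∀ s ∈ Icc s₁ s₂, A y s = 0 := fun y hy s _ => by
    simp [hA, h0 y hy]
  have htime : ∀ y, ∫ s in s₁..s₂, A y s =
      u y s₂ * c y * heatPow 1 (x - y) (t - s₂) - u y s₁ * c y * heatPow 1 (x - y) (t - s₁) := by
    intro y
    by_cases hy : y ∈ tsupport c
    · refine intervalIntegral.integral_eq_sub_of_hasDerivAt
        (f := fun s => u y s * c y * heatPow 1 (x - y) (t - s)) ?_ ?_
      · intro s hs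
        rw [uIcc_of_le h12] at hs
        have d1 := (hu.differentiableAt_time (y, s) ⟨hcΩ hy, hI hs⟩).hasDerivAt
        have d2 := (hasDerivAt_heatPow (x - y) (sub_pos.2 (hlt s hs))).comp s
          ((hasDerivAt_const s t).sub (hasDerivAt_id s))
        refine ((d1.mul_const (c y)).mul d2).congr_deriv ?_
        simp only [hA, hdK, Function.comp]
        simp
        ring
      · refine ContinuousOn.intervalIntegrable ?_
        rw [uIcc_of_le h12]
        exact hAc.comp (f := fun s => (y, s)) (by fun_prop) fun s hs => ⟨hy, hs⟩
    · simp [hA, h0 y hy]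
  have hI' : ∀ s ∈ Icc s₁ s₂, Integrable (fun y => u y s * c y * heatPow 1 (x - y) (t - s)) := by
    intro s hs
    refine integrable_of_continuousOn_of_eq_zero hcs ?_ fun y hy => by simp [h0 y hy]
    have : ContinuousOn (fun q : Plane × ℝ => u q.1 q.2 * c q.1 * heatPow 1 (x - q.1) (t - q.2))
      (tsupport c ×ˢ Icc s₁ s₂) := ((hu.continuousOn.mono hsub).mul hcc).mul (hPc 1)
    exact this.comp (f := fun y => (y, s)) (by fun_prop) fun y hy => ⟨hy, hs⟩
  rw [← integral_sub (hI' s₂ ⟨h12, le_rfl⟩) (hI' s₁ ⟨le_rfl, h12⟩)]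
  simp only [← htime]
  have hint := integrable_prod_of_continuousOn hcs hAc hA0
  rw [← intervalIntegral_integral_swap (f := fun s y => A y s)]
  · refine intervalIntegral.integral_congr fun s hs => ?_
    rw [uIcc_of_le h12] at hs
    have hst := hlt s hs
    set φ : Plane → ℝ := fun y => c y * heatPow 1 (x - y) (t - s) with hφ
    have hφc : ContDiff ℝ 2 φ := hc.mul (contDiff_heatPow_sub 1 x (sub_pos.2 hst))
    have hφs : tsupport φ ⊆ tsupport c := closure_mono (Function.support_mul_subset_left _ _)
    have hg := integral_mul_laplacian_comm hΩ (hu.contDiffOn_slice (hI hs)) hφc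
      (hcs.of_isClosed_subset (isClosed_tsupport _) hφs) (hφs.trans hcΩ)
    have hslice : ContinuousOn (fun y : Plane => (y, s)) (tsupport c) := by fun_prop
    have hmaps : MapsTo (fun y : Plane => (y, s)) (tsupport c) (tsupport c ×ˢ Icc s₁ s₂) :=
      fun y hy => ⟨hy, hs⟩
    have i1 : Integrable (fun y => φ y * Laplacian.laplacian (fun y => u y s) y) := by
      have : ContinuousOn (fun y => φ y * deriv (fun s => u y s) s) (tsupport c) :=
        hφc.continuous.continuousOn.mul
          ((hu.continuousOn_deriv_time.mono hsub).comp hslice hmaps)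
      refine integrable_of_continuousOn_of_eq_zero hcs (this.congr fun y hy => ?_)
        fun y hy => by simp [hφ, h0 y hy]
      simp only [← hu.heat_eq (y, s) ⟨hcΩ hy, hI hs⟩]
    have i2 : Integrable (fun y => u y s * (c y * dK y s)) :=
      integrable_of_continuousOn_of_eq_zero hcs
        (((hu.continuousOn.mono hsub).mul (hcc.mul hdKc)).comp hslice hmaps)
        fun y hy => by simp [h0 y hy]
    have i3 : Integrable (fun y => u y s * Laplacian.laplacian φ y) :=
      integrable_of_continuousOn_of_eq_zero hcs
        (((hu.continuousOn.mono hsub).comp hslice hmaps).mul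
          (continuous_laplacian hφc).continuousOn) fun y hy => by
            rw [hφ, laplacian_mul_heatPow hc x y hst, h0 y hy,
              heatFlux_eq_zero_of_notMem_tsupport hy]
            simp
    calc ∫ y, A y s = ∫ y, (φ y * Laplacian.laplacian (fun y => u y s) y -
          u y s * (c y * dK y s)) := by
          congr 1
          funext y
          by_cases hy : y ∈ tsupport c
          · simp only [hA, hφ, ← hu.heat_eq (y, s) ⟨hcΩ hy, hI hs⟩]
            ring
          · simp [hA, hφ, h0 y hy]
      _ = ∫ y, (u y s * Laplacian.laplacian φ y - u y s * (c y * dK y s)) := by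
          rw [integral_sub i1 i2, hg, integral_sub i3 i2]
      _ = ∫ y, u y s * heatFlux c x t y s := by
          congr 1
          funext y
          rw [hφ, laplacian_mul_heatPow hc x y hst]
          ring
  · rw [uIoc_of_le h12, Measure.restrict_congr_set Ioc_ae_eq_Icc]
    exact hint

end Green

/-- `heatPow 1 · τ / (4 π)` is an approximate identity as `τ → 0`. -/
lemma tendsto_integral_mul_heatPow {w : Plane → ℝ → ℝ} {x : Plane} {t η M : ℝ} (hη : 0 < η)
    (hM : ∀ y, ∀ s ∈ Ioo (t - η) t, |w y s| ≤ M)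
    (hw : ∀ s ∈ Ioo (t - η) t, Continuous fun y => w y s)
    (hwt : ContinuousAt (fun q : Plane × ℝ => w q.1 q.2) (x, t)) :
    Tendsto (fun h => ∫ y, w y (t - h) * heatPow 1 (x - y) h) (𝓝[>] 0) (𝓝 (4 * π * w x t)) := by
  have hgauss : ∫ z : Plane, exp (-(1 / 4) * ‖z‖ ^ 2) = 4 * π := by
    rw [GaussianFourier.integral_rexp_neg_mul_sq_norm (by norm_num)]
    simp
    ring
  have hgi : Integrable fun z : Plane => exp (-(1 / 4) * ‖z‖ ^ 2) := by
    -- A non-integrable function has integral `0` by convention, which contradicts the value `4 π`.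
    by_contra hcon
    rw [integral_undef hcon] at hgauss
    exact (by positivity : (4 * π) ≠ 0) hgauss.symm
  -- The substitution `y = x - √h z` freezes the kernel into a fixed Gaussian of mass `4 π`: the
  -- Jacobian `h` in two dimensions cancels the prefactor `h⁻¹`.
  have hch : ∀ h > 0, ∫ y, w y (t - h) * heatPow 1 (x - y) h =
      ∫ z, w (x - √h • z) (t - h) * exp (-(1 / 4) * ‖z‖ ^ 2) := by
    intro h hh
    have e1 := integral_sub_left_eq_self
      (fun y => w (x - y) (t - h) * heatPow 1 y h) volume x
    simp only [sub_sub_cancel] at e1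
    have e2 := Measure.integral_comp_smul volume
      (fun y : Plane => w (x - y) (t - h) * heatPow 1 y h) (√h)
    rw [e1]
    have e3 : |(√h ^ Module.finrank ℝ Plane)⁻¹| = h⁻¹ := by
      simp [hh.le]
    rw [e3, smul_eq_mul, eq_inv_mul_iff_mul_eq₀ hh.ne', ← integral_const_mul] at e2
    rw [← e2]
    congr 1
    funext z
    rw [heatPow_of_pos _ _ hh, norm_smul, mul_pow, norm_of_nonneg (sqrt_nonneg h), sq_sqrt hh.le]
    have : -(h * ‖z‖ ^ 2) / (4 * h) = -(1 / 4) * ‖z‖ ^ 2 := by field_simp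
    rw [this]
    field_simp
  have key : Tendsto (fun h => ∫ z, w (x - √h • z) (t - h) * exp (-(1 / 4) * ‖z‖ ^ 2)) (𝓝[>] 0)
      (𝓝 (∫ z : Plane, w x t * exp (-(1 / 4) * ‖z‖ ^ 2))) := by
    have hev : ∀ᶠ h in 𝓝[>] (0 : ℝ), t - h ∈ Ioo (t - η) t := by
      filter_upwards [Ioo_mem_nhdsGT hη] with h hh
      exact ⟨by linarith [hh.2], by linarith [hh.1]⟩
    refine tendsto_integral_filter_of_dominated_convergence
      (fun z => M * exp (-(1 / 4) * ‖z‖ ^ 2)) ?_ ?_ (hgi.const_mul M) ?_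
    · filter_upwards [hev] with h hh
      exact (((hw _ hh).comp (by fun_prop)).mul (by fun_prop)).aestronglyMeasurable
    · filter_upwards [hev] with h hh
      refine ae_of_all _ fun z => ?_
      rw [norm_mul, norm_of_nonneg (exp_pos _).le]
      exact mul_le_mul_of_nonneg_right (hM _ _ hh) (exp_pos _).le
    · refine ae_of_all _ fun z => Tendsto.mul_const _ ?_
      have h1 : Tendsto (fun h : ℝ => (x - √h • z, t - h)) (𝓝[>] 0) (𝓝 (x, t)) := by
        have : Continuous fun h : ℝ => (x - √h • z, t - h) := by fun_prop
        have := this.tendsto 0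
        simp only [sqrt_zero, zero_smul, sub_zero] at this
        exact this.mono_left nhdsWithin_le_nhds
      exact hwt.tendsto.comp h1
  rw [integral_const_mul, hgauss, mul_comm] at key
  refine key.congr' ?_
  filter_upwards [self_mem_nhdsWithin] with h hh using (hch h hh).symm

section Representation

variable {Ω : Set Plane} {I : Set ℝ} {u : Plane → ℝ → ℝ} {c : Plane → ℝ}

/-- Only the region where `c` is not locally constant has to lie in a compact subset of `Ω`; `c`
itself need not have compact support. This allows its use for `a` and for `logCutoff L` separately
on the punctured domain. -/
lemma integrable_mul_heatFlux (hu : IsClassicalHeatSolution (Ω ×ˢ I) u) (hc : ContDiff ℝ 2 c)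
    {K : Set Plane} (hK : IsCompact K) (hKΩ : K ⊆ Ω) (hcK : ∀ y ∉ K, ∃ b, c =ᶠ[𝓝 y] fun _ => b)
    {x : Plane} {a : ℝ} (hcx : c =ᶠ[𝓝 x] fun _ => a) {s₁ s₂ : ℝ} (t : ℝ) (hI : Icc s₁ s₂ ⊆ I) :
    Integrable (fun q : ℝ × Plane => u q.2 q.1 * heatFlux c x t q.2 q.1)
      ((volume.restrict (Icc s₁ s₂)).prod volume) :=
  integrable_prod_of_continuousOn (F := fun y s => u y s * heatFlux c x t y s) hK
    ((hu.continuousOn.mono (prod_mono hKΩ hI)).mul (continuous_heatFlux hc hcx t).continuousOn)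
    fun y hy s _ => by
      obtain ⟨b, hb⟩ := hcK y hy
      rw [heatFlux_eq_zero_of_eventuallyEq hb, mul_zero]

/-- Representation of a solution of the heat equation by its values on the support of a cutoff. -/
lemma heat_representation (hΩ : IsOpen Ω) (hIo : IsOpen I)
    (hu : IsClassicalHeatSolution (Ω ×ˢ I) u) (hc : ContDiff ℝ 2 c) (hcs : HasCompactSupport c)
    (hcΩ : tsupport c ⊆ Ω) {x : Plane} (hx : x ∈ Ω) {a : ℝ} (hcx : c =ᶠ[𝓝 x] fun _ => a)
    {s₁ t : ℝ} (h1 : s₁ < t) (hI : Icc s₁ t ⊆ I) :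
    4 * π * (u x t * a) = (∫ y, u y s₁ * c y * heatPow 1 (x - y) (t - s₁)) +
      ∫ s in s₁..t, ∫ y, u y s * heatFlux c x t y s := by
  have h0 : ∀ y ∉ tsupport c, c y = 0 := fun y hy => image_eq_zero_of_notMem_tsupport hy
  have hmaps : ∀ s ∈ Icc s₁ t, MapsTo (fun y : Plane => (y, s)) Ω (Ω ×ˢ I) :=
    fun s hs y hy => ⟨hy, hI hs⟩
  have hcont : ContinuousOn (fun q : Plane × ℝ => u q.1 q.2 * c q.1) (Ω ×ˢ I) :=
    hu.continuousOn.mul (hc.continuous.comp continuous_fst).continuousOn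
  obtain ⟨M, hM⟩ := (hcs.prod isCompact_Icc).exists_bound_of_continuousOn
    (hcont.mono (prod_mono hcΩ hI))
  -- Green's formula needs a final time before the pole, so it is applied at `t - h` and `h → 0`;
  -- the approximate identity recovers `4 π u(x, t)`.
  have lim1 := tendsto_integral_mul_heatPow (w := fun y s => u y s * c y) (x := x) (t := t)
    (η := t - s₁) (M := max M 0) (sub_pos.2 h1)
    (fun y s hs => by
      rw [sub_sub_cancel] at hs
      by_cases hy : y ∈ tsupport c
      · exact (hM (y, s) ⟨hy, hs.1.le, hs.2.le⟩).trans (le_max_left _ _)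
      · simp [h0 y hy])
    (fun s hs => by
      rw [sub_sub_cancel] at hs
      refine continuous_of_tsupport fun y hy => ?_
      have hyΩ : y ∈ Ω := hcΩ (closure_mono (Function.support_mul_subset_right _ _) hy)
      exact ((hcont.comp (f := fun y : Plane => (y, s)) (by fun_prop)
        (hmaps s ⟨hs.1.le, hs.2.le⟩)).continuousAt (hΩ.mem_nhds hyΩ)))
    (hcont.continuousAt ((hΩ.prod hIo).mem_nhds ⟨hx, hI ⟨h1.le, le_rfl⟩⟩))
  have hca : c x = a := hcx.eq_of_nhds
  have hint : IntervalIntegrable (fun s => ∫ y, u y s * heatFlux c x t y s) volume s₁ t := by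
    rw [intervalIntegrable_iff_integrableOn_Icc_of_le h1.le]
    exact (integrable_mul_heatFlux hu hc hcs hcΩ
      (fun y hy => ⟨0, notMem_tsupport_iff_eventuallyEq.1 hy⟩) hcx t hI).integral_prod_left
  have hprim := intervalIntegral.continuousOn_primitive_interval' hint left_mem_uIcc
  rw [uIcc_of_le h1.le] at hprim
  have lim2 : Tendsto (fun h => ∫ s in s₁..(t - h), ∫ y, u y s * heatFlux c x t y s) (𝓝[>] 0)
      (𝓝 (∫ s in s₁..t, ∫ y, u y s * heatFlux c x t y s)) := by
    refine (hprim t ⟨h1.le, le_rfl⟩).tendsto.comp (tendsto_nhdsWithin_iff.2 ⟨?_, ?_⟩)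
    · have : Continuous fun h : ℝ => t - h := by fun_prop
      simpa using (this.tendsto 0).mono_left nhdsWithin_le_nhds
    · filter_upwards [Ioo_mem_nhdsGT (sub_pos.2 h1)] with h hh
      exact ⟨by linarith [hh.2], by linarith [hh.1]⟩
  have hgreen : ∀ᶠ h in 𝓝[>] (0 : ℝ), ∫ y, u y (t - h) * c y * heatPow 1 (x - y) h =
      (∫ y, u y s₁ * c y * heatPow 1 (x - y) (t - s₁)) +
        ∫ s in s₁..(t - h), ∫ y, u y s * heatFlux c x t y s := by
    filter_upwards [Ioo_mem_nhdsGT (sub_pos.2 h1)] with h hh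
    have := integral_mul_heatPow_sub_eq hΩ hu hc hcs hcΩ x (s₁ := s₁) (s₂ := t - h) (t := t)
      (by linarith [hh.2]) (by linarith [hh.1])
      ((Icc_subset_Icc_right (by linarith [hh.1])).trans hI)
    rw [sub_sub_cancel] at this
    linarith
  rw [← hca]
  exact tendsto_nhds_unique lim1 ((lim2.const_add _).congr' (hgreen.mono fun h hh => hh.symm))

end Representation

/-! ### The logarithmic cutoff. -/

/-- The first two derivatives of `Real.smoothTransition` are bounded. -/
lemma exists_bound_deriv_smoothTransition : ∃ C : ℝ, 0 ≤ C ∧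
    (∀ r, |deriv smoothTransition r| ≤ C) ∧ ∀ r, |deriv (deriv smoothTransition) r| ≤ C := by
  have hS : ContDiff ℝ 2 smoothTransition := smoothTransition.contDiff (n := 2)
  have hS1 : ContDiff ℝ 1 (deriv smoothTransition) :=
    (contDiff_succ_iff_deriv (n := 1)).1 (by simpa [one_add_one_eq_two] using hS) |>.2.2
  have hc2 : Continuous (deriv (deriv smoothTransition)) := hS1.continuous_deriv le_rfl
  have hz : ∀ r ∉ Icc (0 : ℝ) 1, ∃ b, smoothTransition =ᶠ[𝓝 r] fun _ => b := by
    intro r hr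
    rcases lt_or_ge r 0 with h | h
    · exact ⟨0, by filter_upwards [Iio_mem_nhds h] with s hs using
        smoothTransition.zero_of_nonpos (le_of_lt hs)⟩
    · have h1 : 1 < r := not_le.1 fun h' => hr ⟨h, h'⟩
      exact ⟨1, by filter_upwards [Ioi_mem_nhds h1] with s hs using
        smoothTransition.one_of_one_le (le_of_lt hs)⟩
  have hz1 : ∀ r ∉ Icc (0 : ℝ) 1, deriv smoothTransition =ᶠ[𝓝 r] fun _ => 0 := by
    intro r hr
    obtain ⟨b, hb⟩ := hz r hr
    simpa using hb.deriv
  obtain ⟨C₁, h₁⟩ := isCompact_Icc.exists_bound_of_continuousOn (s := Icc (0 : ℝ) 1)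
    hS1.continuous.continuousOn
  obtain ⟨C₂, h₂⟩ := isCompact_Icc.exists_bound_of_continuousOn (s := Icc (0 : ℝ) 1)
    hc2.continuousOn
  refine ⟨max 0 (max C₁ C₂), le_max_left _ _, fun r => ?_, fun r => ?_⟩
  · by_cases hr : r ∈ Icc (0 : ℝ) 1
    · exact (h₁ r hr).trans ((le_max_left _ _).trans (le_max_right _ _))
    · simp [(hz1 r hr).eq_of_nhds]
  · by_cases hr : r ∈ Icc (0 : ℝ) 1
    · exact (h₂ r hr).trans ((le_max_right _ _).trans (le_max_right _ _))
    · simp [(hz1 r hr).deriv_eq]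

/-- A smooth cutoff equal to `0` for `|y| ≤ exp (-2 L)` and to `1` for `|y| ≥ exp (-L)`, which is a
function of `log |y| / L`. -/
noncomputable def logCutoff (L : ℝ) (y : Plane) : ℝ :=
  -- The origin is treated apart because `log 0 = 0` would give the value `smoothTransition 2 = 1`
  -- there. The form `‖y - 0‖ ^ 2` matches the radial derivative formulas with centre `0`.
  if y = 0 then 0 else smoothTransition (log (‖y - 0‖ ^ 2) / (2 * L) + 2)

section logCutoff

variable {L : ℝ} {y : Plane}

lemma log_norm_sub_zero_sq (y : Plane) : log (‖y - 0‖ ^ 2) = 2 * log ‖y‖ := by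
  rw [sub_zero, log_pow]
  norm_num

lemma logCutoff_nonneg (L : ℝ) (y : Plane) : 0 ≤ logCutoff L y := by
  unfold logCutoff
  split_ifs
  exacts [le_rfl, smoothTransition.nonneg _]

lemma logCutoff_le_one (L : ℝ) (y : Plane) : logCutoff L y ≤ 1 := by
  unfold logCutoff
  split_ifs
  exacts [zero_le_one, smoothTransition.le_one _]

lemma logCutoff_eq_one (hL : 0 < L) (hy : exp (-L) ≤ ‖y‖) : logCutoff L y = 1 := by
  have hy0 : 0 < ‖y‖ := (exp_pos _).trans_le hy
  rw [logCutoff, if_neg (norm_pos_iff.1 hy0), log_norm_sub_zero_sq]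
  apply smoothTransition.one_of_one_le
  have : -L ≤ log ‖y‖ := (le_log_iff_exp_le hy0).2 hy
  have h2 : -1 ≤ 2 * log ‖y‖ / (2 * L) := by
    rw [le_div_iff₀ (by positivity)]
    linarith
  linarith

lemma logCutoff_eq_zero (hL : 0 < L) (hy : ‖y‖ ≤ exp (-(2 * L))) : logCutoff L y = 0 := by
  unfold logCutoff
  split_ifs with h
  · rfl
  · have hy0 : 0 < ‖y‖ := norm_pos_iff.2 h
    rw [log_norm_sub_zero_sq]
    apply smoothTransition.zero_of_nonpos
    have : log ‖y‖ ≤ -(2 * L) := (log_le_iff_le_exp hy0).2 hy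
    have h2 : 2 * log ‖y‖ / (2 * L) ≤ -2 := by
      rw [div_le_iff₀ (by positivity)]
      linarith
    linarith

lemma logCutoff_eventuallyEq_one (hL : 0 < L) (hy : exp (-L) < ‖y‖) :
    logCutoff L =ᶠ[𝓝 y] fun _ => 1 := by
  filter_upwards [continuous_norm.continuousAt.eventually (lt_mem_nhds hy)] with z hz using
    logCutoff_eq_one hL (le_of_lt hz)

lemma logCutoff_eventuallyEq_zero (hL : 0 < L) (hy : ‖y‖ < exp (-(2 * L))) :
    logCutoff L =ᶠ[𝓝 y] fun _ => 0 := by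
  filter_upwards [continuous_norm.continuousAt.eventually (gt_mem_nhds hy)] with z hz using
    logCutoff_eq_zero hL (le_of_lt hz)

lemma logCutoff_eventuallyEq (hy : y ≠ 0) :
    logCutoff L =ᶠ[𝓝 y] fun y => smoothTransition (log (‖y - 0‖ ^ 2) / (2 * L) + 2) := by
  filter_upwards [isOpen_ne.mem_nhds hy] with z hz using if_neg hz

lemma contDiff_logCutoff (hL : 0 < L) : ContDiff ℝ 2 (logCutoff L) := by
  rw [contDiff_iff_contDiffAt]
  intro y
  by_cases hy : y = 0
  · exact contDiffAt_const.congr_of_eventuallyEq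
      (logCutoff_eventuallyEq_zero hL (by simpa [hy] using exp_pos _))
  · refine ContDiffAt.congr_of_eventuallyEq ?_ (logCutoff_eventuallyEq hy)
    have h1 : ContDiffAt ℝ 2 (fun y : Plane => ‖y - 0‖ ^ 2) y :=
      (contDiffAt_id.sub contDiffAt_const).norm_sq ℝ
    exact (smoothTransition.contDiffAt (n := 2)).comp y
      (((h1.log (by simpa using hy)).div_const _).add contDiffAt_const)

lemma hasDerivAt_smoothTransition_log {r : ℝ} (hr : 0 < r) :
    HasDerivAt (fun r => smoothTransition (log r / (2 * L) + 2))
      (deriv smoothTransition (log r / (2 * L) + 2) * (r⁻¹ / (2 * L))) r := by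
  have h1 : HasDerivAt (fun r => log r / (2 * L) + 2) (r⁻¹ / (2 * L)) r :=
    ((hasDerivAt_log hr.ne').div_const _).add_const _
  have h2 : HasDerivAt smoothTransition (deriv smoothTransition (log r / (2 * L) + 2))
      (log r / (2 * L) + 2) :=
    ((smoothTransition.contDiffAt (n := 1)).differentiableAt (by simp)).hasDerivAt
  exact h2.comp r h1

lemma fderiv_logCutoff (hy : y ≠ 0) (hL : 0 < L) :
    fderiv ℝ (logCutoff L) y =
      (deriv smoothTransition (log (‖y - 0‖ ^ 2) / (2 * L) + 2) / (L * ‖y‖ ^ 2)) • innerSL ℝ y := by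
  have hy0 : 0 < ‖y‖ := norm_pos_iff.2 hy
  have hp : 0 < ‖y - 0‖ ^ 2 := by rw [sub_zero]; positivity
  rw [(logCutoff_eventuallyEq hy).fderiv_eq,
    (hasFDerivAt_comp_norm_sub_sq (hasDerivAt_smoothTransition_log (L := L) hp)).fderiv]
  rw [sub_zero]
  congr 1
  field_simp

/-- Because `log |y|` is harmonic in the plane, the first-derivative term of the chain rule drops
out. Only the second derivative survives, with the decisive factor `L⁻²`. -/
lemma laplacian_logCutoff (hy : y ≠ 0) (hL : 0 < L) :
    Laplacian.laplacian (logCutoff L) y =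
      deriv (deriv smoothTransition) (log (‖y - 0‖ ^ 2) / (2 * L) + 2) / (L ^ 2 * ‖y‖ ^ 2) := by
  have hy0 : 0 < ‖y‖ := norm_pos_iff.2 hy
  have hp : 0 < ‖y - 0‖ ^ 2 := by rw [sub_zero]; positivity
  have hS1 : ContDiff ℝ 1 (deriv smoothTransition) :=
    (contDiff_succ_iff_deriv (n := 1)).1 (by
      simpa [one_add_one_eq_two] using smoothTransition.contDiff (n := 2)) |>.2.2
  rw [(InnerProductSpace.laplacian_congr_nhds (logCutoff_eventuallyEq hy)).eq_of_nhds]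
  have h1 : ∀ᶠ r in 𝓝 (‖y - 0‖ ^ 2),
      HasDerivAt (fun r => smoothTransition (log r / (2 * L) + 2))
      (deriv smoothTransition (log r / (2 * L) + 2) * (r⁻¹ / (2 * L))) r := by
    filter_upwards [lt_mem_nhds hp] with r hr using hasDerivAt_smoothTransition_log hr
  have h2 : HasDerivAt (fun r => log r / (2 * L) + 2) ((‖y - 0‖ ^ 2)⁻¹ / (2 * L)) (‖y - 0‖ ^ 2) :=
    ((hasDerivAt_log hp.ne').div_const _).add_const _
  have h3 : HasDerivAt (deriv smoothTransition)
      (deriv (deriv smoothTransition) (log (‖y - 0‖ ^ 2) / (2 * L) + 2))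
      (log (‖y - 0‖ ^ 2) / (2 * L) + 2) :=
    (hS1.contDiffAt.differentiableAt (by simp)).hasDerivAt
  have h4 := (HasDerivAt.comp (‖y - 0‖ ^ 2) h3 h2).mul ((hasDerivAt_inv hp.ne').div_const (2 * L))
  rw [laplacian_comp_norm_sub_sq h1 h4]
  simp only [Function.comp, sub_zero]
  field_simp
  ring

/-- The flux of the logarithmic cutoff. -/
lemma exists_bound_heatFlux_logCutoff : ∃ C : ℝ, 0 ≤ C ∧ ∀ {L : ℝ}, 0 < L → ∀ {y : Plane}, y ≠ 0 →
    ∀ (x : Plane) (t s : ℝ), |heatFlux (logCutoff L) x t y s| ≤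
      C * ‖x - y‖ / (L * ‖y‖) * heatPow 2 (x - y) (t - s) +
        C / (L ^ 2 * ‖y‖ ^ 2) * heatPow 1 (x - y) (t - s) := by
  obtain ⟨C, hC, h1, h2⟩ := exists_bound_deriv_smoothTransition
  refine ⟨C, hC, fun {L} hL {y} hy x t s => ?_⟩
  have hy0 : 0 < ‖y‖ := norm_pos_iff.2 hy
  rw [heatFlux, fderiv_logCutoff hy hL, laplacian_logCutoff hy hL]
  refine (abs_add_le _ _).trans (add_le_add ?_ ?_)
  · rw [abs_mul, abs_of_nonneg (heatPow_nonneg _ _ _)]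
    refine mul_le_mul_of_nonneg_right ?_ (heatPow_nonneg _ _ _)
    rw [smul_apply, innerSL_apply_apply, smul_eq_mul, abs_mul, abs_div,
      abs_of_pos (by positivity : 0 < L * ‖y‖ ^ 2)]
    calc _ ≤ C / (L * ‖y‖ ^ 2) * (‖y‖ * ‖x - y‖) :=
          mul_le_mul (div_le_div_of_nonneg_right (h1 _) (by positivity))
            (abs_real_inner_le_norm _ _) (abs_nonneg _) (by positivity)
      _ = _ := by field_simp
  · rw [abs_mul, abs_of_nonneg (heatPow_nonneg _ _ _)]
    refine mul_le_mul_of_nonneg_right ?_ (heatPow_nonneg _ _ _)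
    rw [abs_div, abs_of_pos (by positivity : 0 < L ^ 2 * ‖y‖ ^ 2)]
    exact div_le_div_of_nonneg_right (h2 _) (by positivity)

end logCutoff

/-! ### Estimates near the singular point. -/

/-- Integrals of `|y|⁻²` over annuli. -/
lemma exists_integral_annulus : ∃ V : ℝ, 0 ≤ V ∧ ∀ a b : ℝ, 0 < a → a ≤ b →
    Integrable (fun y : Plane => (Icc a b).indicator (fun r => (r ^ 2)⁻¹) ‖y‖) ∧
      ∫ y : Plane, (Icc a b).indicator (fun r => (r ^ 2)⁻¹) ‖y‖ = V * log (b / a) := by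
  refine ⟨2 * volume.real (Metric.ball (0 : Plane) 1), by positivity, fun a b ha hab => ?_⟩
  have hfun : ∀ r : ℝ, r ^ (Module.finrank ℝ Plane - 1) •
      (Icc a b).indicator (fun r => (r ^ 2)⁻¹) r = (Icc a b).indicator (fun r => r⁻¹) r := by
    intro r
    by_cases hr : r ∈ Icc a b
    · have : r ≠ 0 := (ha.trans_le hr.1).ne'
      simp [hr]
      field_simp
    · simp [hr]
  have hsub : Icc a b ⊆ Ioi 0 := fun r hr => ha.trans_le hr.1
  have hii : IntegrableOn (fun r : ℝ => r⁻¹) (Icc a b) :=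
    (continuousOn_inv₀.mono fun r hr => (hsub hr).ne').integrableOn_Icc
  constructor
  · rw [integrable_fun_norm_addHaar volume (f := (Icc a b).indicator (fun r => (r ^ 2)⁻¹))]
    simp only [hfun]
    exact ((integrable_indicator_iff measurableSet_Icc).2 hii).integrableOn
  · rw [integral_fun_norm_addHaar volume ((Icc a b).indicator (fun r => (r ^ 2)⁻¹))]
    simp only [hfun]
    rw [setIntegral_indicator measurableSet_Icc, inter_eq_self_of_subset_right hsub,
      integral_Icc_eq_integral_Ioc, ← intervalIntegral.integral_of_le hab,
      integral_inv_of_pos ha (ha.trans_le hab)]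
    simp
    ring

lemma integrableOn_inv_norm (r : ℝ) :
    IntegrableOn (fun y : Plane => ‖y‖⁻¹) (Metric.ball 0 r) := by
  rw [integrableOn_fun_norm_addHaar volume (f := fun r => r⁻¹)]
  have : IntegrableOn (fun _ : ℝ => (1 : ℝ)) (Ioo 0 r) := by simp
  refine this.congr_fun (fun s hs => ?_) measurableSet_Ioo
  have : s ≠ 0 := hs.1.ne'
  simp [this]

section Punctured

variable {Ω : Set Plane} {I : Set ℝ} {u : Plane → ℝ → ℝ}

/-- For `|y| ≤ |x| / 2` the point stays away from the pole `x`, where the kernel is continuous even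
across `s = t`; compactness does the rest. -/
lemma exists_bound_heatPow_sub (k : ℕ) {x : Plane} (hx : x ≠ 0) (a b t : ℝ) : ∃ M : ℝ, 0 ≤ M ∧
    ∀ y : Plane, ‖y‖ ≤ ‖x‖ / 2 → ∀ s ∈ Icc a b, heatPow k (x - y) (t - s) ≤ M := by
  have hx0 : 0 < ‖x‖ := norm_pos_iff.2 hx
  have hc : ContinuousOn (fun q : Plane × ℝ => heatPow k (x - q.1) (t - q.2))
      (Metric.closedBall 0 (‖x‖ / 2) ×ˢ Icc a b) := by
    rintro ⟨y, s⟩ ⟨hy, -⟩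
    refine (continuousAt_heatPow_sub k (Or.inl ?_)).continuousWithinAt
    rintro rfl
    simp only [mem_closedBall_zero_iff] at hy
    linarith
  obtain ⟨M, hM⟩ := ((isCompact_closedBall _ _).prod isCompact_Icc).exists_bound_of_continuousOn hc
  refine ⟨max M 0, le_max_right _ _, fun y hy s hs => ?_⟩
  exact (le_abs_self _).trans ((hM (y, s) ⟨by simpa using hy, hs⟩).trans (le_max_left _ _))

/-- The growth condition makes the contribution of the logarithmic cutoff vanish in the limit. -/
lemma tendsto_integral_mul_heatFlux_logCutoff {s₁ t : ℝ} (h1 : s₁ < t)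
    (hgrow : ∀ δ : ℝ, 0 < δ → ∃ R₀ : ℝ, 0 < R₀ ∧ ∀ y : Plane, 0 < ‖y‖ → ‖y‖ ≤ R₀ →
      ∀ s ∈ Icc s₁ t, |u y s| ≤ δ * log (1 / ‖y‖)) {x : Plane} (hx : x ≠ 0) :
    Tendsto (fun L => ∫ s in s₁..t, ∫ y, u y s * heatFlux (logCutoff L) x t y s) atTop (𝓝 0) := by
  have hx0 : 0 < ‖x‖ := norm_pos_iff.2 hx
  obtain ⟨C, hC, hflux⟩ := exists_bound_heatFlux_logCutoff
  obtain ⟨V, hV, hann⟩ := exists_integral_annulus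
  obtain ⟨M₁, hM₁, hb₁⟩ := exists_bound_heatPow_sub 1 hx s₁ t t
  obtain ⟨M₂, hM₂, hb₂⟩ := exists_bound_heatPow_sub 2 hx s₁ t t
  set B : ℝ := 2 * (2 * C * ‖x‖ * M₂ + C * M₁) * V * (t - s₁) with hB
  have hB0 : 0 ≤ B := by
    have := sub_pos.2 h1
    positivity
  rw [Metric.tendsto_atTop]
  intro ε hε
  have hδ : 0 < ε / (B + 1) := by positivity
  set δ := ε / (B + 1) with hδdef
  obtain ⟨R₀, hR₀, hu⟩ := hgrow δ hδ
  obtain ⟨L₀, hL₀⟩ : ∃ L₀ : ℝ, ∀ L ≥ L₀, exp (-L) ≤ min R₀ (‖x‖ / 2) := by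
    have := (tendsto_exp_neg_atTop_nhds_zero).eventually
      (gt_mem_nhds (lt_min hR₀ (half_pos hx0)))
    obtain ⟨L₀, h⟩ := eventually_atTop.1 this
    exact ⟨L₀, fun L hL => (h L hL).le⟩
  refine ⟨max L₀ 1, fun L hL => ?_⟩
  have hL1 : 1 ≤ L := (le_max_right _ _).trans hL
  have hLpos : 0 < L := by linarith
  have hexp := hL₀ L ((le_max_left _ _).trans hL)
  -- On the annulus this yields `L |y| ≤ 1`, so the gradient term `1 / (L |y|)` is also bounded by
  -- `1 / (L² |y|²)`.
  have hLe : L * exp (-L) ≤ 1 := by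
    rw [exp_neg, ← div_eq_mul_inv, div_le_one (exp_pos _)]
    linarith [add_one_le_exp L]
  have hpt : ∀ s ∈ Icc s₁ t, ∀ y : Plane, ‖u y s * heatFlux (logCutoff L) x t y s‖ ≤
      δ * (2 * (2 * C * ‖x‖ * M₂ + C * M₁)) / L *
        (Icc (exp (-(2 * L))) (exp (-L))).indicator (fun r => (r ^ 2)⁻¹) ‖y‖ := by
    intro s hs y
    by_cases hy : ‖y‖ ∈ Icc (exp (-(2 * L))) (exp (-L))
    · have hy0 : 0 < ‖y‖ := (exp_pos _).trans_le hy.1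
      have hyx : ‖y‖ ≤ ‖x‖ / 2 := hy.2.trans (hexp.trans (min_le_right _ _))
      rw [indicator_of_mem hy, norm_mul, norm_eq_abs, norm_eq_abs]
      -- The inner radius `exp (-2L)` gives `log (1 / |y|) ≤ 2 L`.
      have e1 : |u y s| ≤ δ * (2 * L) := by
        refine (hu y hy0 (hy.2.trans (hexp.trans (min_le_left _ _))) s hs).trans ?_
        refine mul_le_mul_of_nonneg_left ?_ hδ.le
        rw [one_div, log_inv]
        linarith [(le_log_iff_exp_le hy0).2 hy.1]
      have hxy : ‖x - y‖ ≤ 2 * ‖x‖ := (norm_sub_le _ _).trans (by linarith)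
      have hLy : L * ‖y‖ ≤ 1 := (mul_le_mul_of_nonneg_left hy.2 hLpos.le).trans hLe
      have e2 : |heatFlux (logCutoff L) x t y s| ≤
          (2 * C * ‖x‖ * M₂ + C * M₁) / (L ^ 2 * ‖y‖ ^ 2) := by
        refine (hflux hLpos (norm_pos_iff.1 hy0) x t s).trans ?_
        rw [add_div]
        refine add_le_add ?_ ?_
        · have f1 : C * ‖x - y‖ / (L * ‖y‖) ≤ 2 * C * ‖x‖ / (L ^ 2 * ‖y‖ ^ 2) := by
            rw [div_le_div_iff₀ (by positivity) (by positivity)]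
            calc C * ‖x - y‖ * (L ^ 2 * ‖y‖ ^ 2) =
                  (C * ‖x - y‖) * (L * ‖y‖) * (L * ‖y‖) := by ring
              _ ≤ (C * (2 * ‖x‖)) * (L * ‖y‖) * 1 := by gcongr
              _ = 2 * C * ‖x‖ * (L * ‖y‖) := by ring
          calc _ ≤ 2 * C * ‖x‖ / (L ^ 2 * ‖y‖ ^ 2) * M₂ :=
                mul_le_mul f1 (hb₂ y hyx s hs) (heatPow_nonneg _ _ _) (by positivity)
            _ = _ := by ring
        · calc _ ≤ C / (L ^ 2 * ‖y‖ ^ 2) * M₁ :=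
                mul_le_mul_of_nonneg_left (hb₁ y hyx s hs) (by positivity)
            _ = _ := by ring
      calc _ ≤ δ * (2 * L) * ((2 * C * ‖x‖ * M₂ + C * M₁) / (L ^ 2 * ‖y‖ ^ 2)) :=
            mul_le_mul e1 e2 (abs_nonneg _) (by positivity)
        _ = _ := by field_simp
    · have hz : ∃ b, logCutoff L =ᶠ[𝓝 y] fun _ => b := by
        rcases lt_or_ge ‖y‖ (exp (-(2 * L))) with h | h
        · exact ⟨0, logCutoff_eventuallyEq_zero hLpos h⟩
        · exact ⟨1, logCutoff_eventuallyEq_one hLpos (not_le.1 fun h' => hy ⟨h, h'⟩)⟩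
      obtain ⟨b, hb⟩ := hz
      rw [heatFlux_eq_zero_of_eventuallyEq hb, indicator_of_notMem hy]
      simp
  obtain ⟨hi, hie⟩ := hann (exp (-(2 * L))) (exp (-L)) (exp_pos _) (exp_le_exp.2 (by linarith))
  -- The annulus integral contributes a factor `L`, cancelling the remaining `1 / L` in the
  -- pointwise bound.
  have hlog : log (exp (-L) / exp (-(2 * L))) = L := by
    rw [← exp_sub, log_exp]
    ring
  rw [hlog] at hie
  have hin : ∀ s ∈ Icc s₁ t, ‖∫ y, u y s * heatFlux (logCutoff L) x t y s‖ ≤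
      δ * (2 * (2 * C * ‖x‖ * M₂ + C * M₁)) * V := by
    intro s hs
    refine (norm_integral_le_of_norm_le (hi.const_mul _) (ae_of_all _ (hpt s hs))).trans ?_
    rw [integral_const_mul, hie]
    apply le_of_eq
    field_simp
  have hout := intervalIntegral.norm_integral_le_of_norm_le_const (a := s₁) (b := t)
    (f := fun s => ∫ y, u y s * heatFlux (logCutoff L) x t y s) (fun s hs => hin s (by
      rw [uIoc_of_le h1.le] at hs
      exact ⟨hs.1.le, hs.2⟩))
  rw [dist_zero_right]
  refine hout.trans_lt ?_
  rw [abs_of_pos (sub_pos.2 h1)]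
  calc δ * (2 * (2 * C * ‖x‖ * M₂ + C * M₁)) * V * (t - s₁) = δ * B := by rw [hB]; ring
    _ < δ * (B + 1) := by nlinarith
    _ = ε := by rw [hδdef]; field_simp

/-- A function of logarithmic growth, continuous off the origin, is integrable near the origin. -/
lemma integrableOn_of_le_log {f : Plane → ℝ} (hf : ContinuousOn f (Ω \ {0}))
    {R R₀ : ℝ} (hR : Metric.closedBall 0 R ⊆ Ω) (hR₀ : 0 < R₀)
    (hb : ∀ y : Plane, 0 < ‖y‖ → ‖y‖ ≤ R₀ → |f y| ≤ log (1 / ‖y‖)) :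
    IntegrableOn f (Metric.closedBall 0 R) := by
  -- Near the origin `log (1 / |y|) ≤ |y|⁻¹` gives an integrable majorant; the rest is compact and
  -- avoids the origin.
  have hcov : Metric.closedBall (0 : Plane) R ⊆
      (Metric.closedBall 0 R ∩ Metric.ball 0 R₀) ∪ (Metric.closedBall 0 R \ Metric.ball 0 R₀) := by
    rw [inter_union_sdiff]
  refine IntegrableOn.mono_set (IntegrableOn.union ?_ ?_) hcov
  · have hm : MeasurableSet (Metric.closedBall (0 : Plane) R ∩ Metric.ball 0 R₀) :=
      measurableSet_closedBall.inter measurableSet_ball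
    have hg := (integrableOn_inv_norm R₀).mono_set
      (inter_subset_right (s := Metric.closedBall (0 : Plane) R))
    have h0 : ∀ᵐ y : Plane ∂volume, y ≠ 0 := by
      simp [ae_iff]
    refine Integrable.mono' hg ?_ ?_
    · have h1 : AEStronglyMeasurable f
          (volume.restrict ((Metric.closedBall (0 : Plane) R ∩ Metric.ball 0 R₀) \ {0})) :=
        (hf.mono (sdiff_subset_sdiff_left (inter_subset_left.trans hR))).aestronglyMeasurable
          (hm.diff (measurableSet_singleton _))
      rwa [Measure.restrict_congr_set (sdiff_null_ae_eq_self (measure_singleton _))] at h1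
    · filter_upwards [ae_restrict_mem hm, ae_restrict_of_ae h0] with y hy hy0
      have hy1 : 0 < ‖y‖ := norm_pos_iff.2 hy0
      refine (hb y hy1 (by simpa using (mem_ball_zero_iff.1 hy.2).le)).trans ?_
      rw [one_div]
      exact (log_le_sub_one_of_pos (by positivity)).trans (by linarith)
  · refine ContinuousOn.integrableOn_compact ((isCompact_closedBall _ _).diff Metric.isOpen_ball) ?_
    refine hf.mono fun y hy => ⟨hR hy.1, ?_⟩
    rintro rfl
    exact hy.2 (Metric.mem_ball_self hR₀)

/-- Representation of a solution of logarithmic growth near a singular point, without a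
contribution of the singularity. -/
theorem punctured_heat_representation (hΩ : IsOpen Ω) (hIo : IsOpen I)
    (hu : IsClassicalHeatSolution ((Ω \ {0}) ×ˢ I) u) (a : ContDiffBump (0 : Plane))
    (ha : Metric.closedBall 0 a.rOut ⊆ Ω) {s₁ t : ℝ} (h1 : s₁ < t) (hI : Icc s₁ t ⊆ I)
    (hgrow : ∀ δ : ℝ, 0 < δ → ∃ R₀ : ℝ, 0 < R₀ ∧ ∀ y : Plane, 0 < ‖y‖ → ‖y‖ ≤ R₀ →
      ∀ s ∈ Icc s₁ t, |u y s| ≤ δ * log (1 / ‖y‖)) {x : Plane} (hx : x ≠ 0)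
    (hxa : ‖x‖ < a.rIn) :
    4 * π * u x t = (∫ y, u y s₁ * a y * heatPow 1 (x - y) (t - s₁)) +
      ∫ s in s₁..t, ∫ y, u y s * heatFlux a x t y s := by
  have hx0 : 0 < ‖x‖ := norm_pos_iff.2 hx
  have hΩ' : IsOpen (Ω \ {0}) := hΩ.sdiff isClosed_singleton
  have hac : ContDiff ℝ 2 a := a.contDiff (n := 2)
  -- For large `L` this equals the product of the two cutoffs, since `a = 1` wherever the
  -- logarithmic cutoff differs from `1`. The additive form makes the flux split into two summands.
  set c : ℝ → Plane → ℝ := fun L y => a y + (logCutoff L y - 1) with hcdef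
  have hae : ∀ y : Plane, ‖y‖ < a.rIn → (a : Plane → ℝ) =ᶠ[𝓝 y] fun _ => 1 := fun y hy =>
    a.eventuallyEq_one_of_mem_ball (by simpa using hy)
  have ha0 : ∀ y : Plane, a.rOut ≤ ‖y‖ → a y = 0 := fun y hy =>
    a.zero_of_le_dist (by simpa using hy)
  have hx1 : x ∈ Ω \ {0} :=
    ⟨ha (by simpa using (hxa.trans a.rIn_lt_rOut).le), hx⟩
  have hsmall : ∀ᶠ L : ℝ in atTop, 0 < L ∧ exp (-L) < ‖x‖ :=
    (eventually_gt_atTop 0).and (tendsto_exp_neg_atTop_nhds_zero.eventually (gt_mem_nhds hx0))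
  have hcsub : ∀ L, 0 < L → exp (-L) < ‖x‖ → tsupport (c L) ⊆
      Metric.closedBall 0 a.rOut \ Metric.ball 0 (exp (-(2 * L))) := by
    intro L hL hLx
    refine closure_minimal (fun y hy => ?_) (Metric.isClosed_closedBall.sdiff Metric.isOpen_ball)
    have hLL : exp (-(2 * L)) ≤ exp (-L) := exp_le_exp.2 (by linarith)
    constructor
    · by_contra h
      rw [mem_closedBall_zero_iff, not_le] at h
      refine hy ?_
      simp only [hcdef, ha0 y h.le]
      rw [logCutoff_eq_one hL (hLx.le.trans ((hxa.trans a.rIn_lt_rOut).trans h).le)]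
      simp
    · intro h
      rw [mem_ball_zero_iff] at h
      refine hy ?_
      simp only [hcdef, logCutoff_eq_zero hL h.le]
      rw [(hae y (by linarith)).eq_of_nhds]
      simp
  have hident : ∀ᶠ L : ℝ in atTop, 4 * π * u x t =
      (∫ y, u y s₁ * c L y * heatPow 1 (x - y) (t - s₁)) +
        ((∫ s in s₁..t, ∫ y, u y s * heatFlux a x t y s) +
          ∫ s in s₁..t, ∫ y, u y s * heatFlux (logCutoff L) x t y s) := by
    filter_upwards [hsmall] with L ⟨hL, hLx⟩
    have hχ := contDiff_logCutoff hL
    have hcc : ContDiff ℝ 2 (c L) := hac.add (hχ.sub contDiff_const)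
    have hcs : HasCompactSupport (c L) :=
      ((isCompact_closedBall _ _).diff Metric.isOpen_ball).of_isClosed_subset
        (isClosed_tsupport _) (hcsub L hL hLx)
    have hnot : ∀ {r : ℝ}, 0 < r → ∀ {R}, R ≤ a.rOut →
        Metric.closedBall 0 R \ Metric.ball (0 : Plane) r ⊆ Ω \ {0} := by
      intro r hr R hR y hy
      refine ⟨ha (Metric.closedBall_subset_closedBall hR hy.1), ?_⟩
      rintro rfl
      exact hy.2 (Metric.mem_ball_self hr)
    have hax := hae x hxa
    have hχx := logCutoff_eventuallyEq_one hL hLx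
    have hcx : c L =ᶠ[𝓝 x] fun _ => 1 := by
      filter_upwards [hax, hχx] with y h1 h2
      simp [hcdef, h1, h2]
    have hrep := heat_representation hΩ' hIo hu hcc hcs
      ((hcsub L hL hLx).trans (hnot (exp_pos _) le_rfl)) hx1 hcx h1 hI
    rw [mul_one] at hrep
    rw [hrep]
    congr 1
    have ia := integrable_mul_heatFlux hu hac
      ((isCompact_closedBall (0 : Plane) a.rOut).diff (Metric.isOpen_ball (x := 0) (ε := a.rIn)))
      (hnot a.rIn_pos le_rfl) (fun y hy => by
        by_cases h : ‖y‖ < a.rIn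
        · exact ⟨1, hae y h⟩
        · refine ⟨0, notMem_tsupport_iff_eventuallyEq.1 fun h' => hy ⟨?_, by simpa using h⟩⟩
          rwa [a.tsupport_eq] at h') hax t hI
    have iχ := integrable_mul_heatFlux hu hχ
      ((isCompact_closedBall (0 : Plane) (exp (-L))).diff
        (Metric.isOpen_ball (x := 0) (ε := exp (-(2 * L)))))
      (hnot (exp_pos _) (hLx.le.trans (hxa.trans a.rIn_lt_rOut).le)) (fun y hy => by
        by_cases h : ‖y‖ < exp (-(2 * L))
        · exact ⟨0, logCutoff_eventuallyEq_zero hL h⟩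
        · refine ⟨1, logCutoff_eventuallyEq_one hL (not_le.1 fun h' => hy ⟨?_, ?_⟩)⟩
          · simpa using h'
          · simpa using h) hχx t hI
    have hflux : ∀ y s, heatFlux (c L) x t y s =
        heatFlux a x t y s + heatFlux (logCutoff L) x t y s := by
      intro y s
      have e1 : fderiv ℝ (c L) y = fderiv ℝ a y + fderiv ℝ (logCutoff L) y := by
        have d1 : DifferentiableAt ℝ a y := hac.contDiffAt.differentiableAt (by simp)
        have d2 : DifferentiableAt ℝ (logCutoff L) y := hχ.contDiffAt.differentiableAt (by simp)
        rw [hcdef, fderiv_fun_add d1 (d2.sub_const 1), fderiv_sub_const]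
      have e2 : Laplacian.laplacian (c L) y =
          Laplacian.laplacian (a : Plane → ℝ) y + Laplacian.laplacian (logCutoff L) y := by
        have hk := InnerProductSpace.laplacian_const (E := Plane) (c := (1 : ℝ))
        have hsub := hχ.contDiffAt.laplacian_sub (contDiffAt_const (x := y) (c := (1 : ℝ)))
        have hadd : (Laplacian.laplacian ((a : Plane → ℝ) + (logCutoff L - fun _ => 1)) :
            Plane → ℝ) y = Laplacian.laplacian (a : Plane → ℝ) y +
              (Laplacian.laplacian (logCutoff L - fun _ => (1 : ℝ)) : Plane → ℝ) y :=
          hac.contDiffAt.laplacian_add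
            ((hχ.contDiffAt (x := y)).sub (contDiffAt_const (c := (1 : ℝ))))
        have hk' := congrFun hk y
        have hcL : c L = (a : Plane → ℝ) + (logCutoff L - fun _ => 1) := rfl
        rw [hcL, hadd, hsub, hk']
        simp
      simp only [heatFlux, e1, e2, add_apply]
      ring
    have ja : IntervalIntegrable (fun s => ∫ y, u y s * heatFlux a x t y s) volume s₁ t := by
      rw [intervalIntegrable_iff_integrableOn_Icc_of_le h1.le]
      exact ia.integral_prod_left
    have jχ : IntervalIntegrable (fun s => ∫ y, u y s * heatFlux (logCutoff L) x t y s)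
        volume s₁ t := by
      rw [intervalIntegrable_iff_integrableOn_Icc_of_le h1.le]
      exact iχ.integral_prod_left
    rw [← intervalIntegral.integral_add ja jχ]
    refine intervalIntegral.integral_congr_ae ?_
    have hae1 := ia.prod_right_ae
    have hae2 := iχ.prod_right_ae
    rw [ae_restrict_iff' measurableSet_Icc] at hae1 hae2
    filter_upwards [hae1, hae2] with s hs1 hs2 hs
    rw [uIoc_of_le h1.le] at hs
    rw [← integral_add (hs1 ⟨hs.1.le, hs.2⟩) (hs2 ⟨hs.1.le, hs.2⟩)]
    congr 1
    funext y
    simp only [hflux, mul_add]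
  -- Dominated convergence on the initial slice: `|c L| ≤ 1`, the kernel is at most `(t - s₁)⁻¹`,
  -- `u` is integrable there, and `c L y = a y` for large `L` at each `y ≠ 0`.
  have hlim : Tendsto (fun L => ∫ y, u y s₁ * c L y * heatPow 1 (x - y) (t - s₁)) atTop
      (𝓝 (∫ y, u y s₁ * a y * heatPow 1 (x - y) (t - s₁))) := by
    have hs₁ : s₁ ∈ Icc s₁ t := ⟨le_rfl, h1.le⟩
    obtain ⟨R₀, hR₀, hb⟩ := hgrow 1 one_pos
    have hucont : ContinuousOn (fun y => u y s₁) (Ω \ {0}) :=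
      (hu.contDiffOn_slice (hI hs₁)).continuousOn
    have hui : IntegrableOn (fun y => u y s₁) (Metric.closedBall 0 a.rOut) :=
      integrableOn_of_le_log hucont ha hR₀ fun y hy hy' => by
        simpa using hb y hy hy' s₁ hs₁
    have hui' : Integrable ((Metric.closedBall 0 a.rOut).indicator fun y => u y s₁) :=
      (integrable_indicator_iff measurableSet_closedBall).2 hui
    have hPle : ∀ y, heatPow 1 (x - y) (t - s₁) ≤ (t - s₁)⁻¹ := by
      intro y
      have := sub_pos.2 h1
      rw [heatPow_of_pos _ _ this, pow_one]
      refine mul_le_of_le_one_right (by positivity) (exp_le_one_iff.2 ?_)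
      rw [neg_div]
      exact neg_nonpos.2 (by positivity)
    have hczero : ∀ L, 0 < L → exp (-L) < ‖x‖ → ∀ y ∉ Metric.closedBall 0 a.rOut, c L y = 0 :=
      fun L hL hLx y hy => image_eq_zero_of_notMem_tsupport fun h => hy (hcsub L hL hLx h).1
    have hind : ∀ᶠ L : ℝ in atTop, ∀ y, u y s₁ * c L y * heatPow 1 (x - y) (t - s₁) =
        (Metric.closedBall 0 a.rOut).indicator (fun y => u y s₁) y *
          (c L y * heatPow 1 (x - y) (t - s₁)) := by
      filter_upwards [hsmall] with L ⟨hL, hLx⟩ y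
      by_cases hy : y ∈ Metric.closedBall 0 a.rOut
      · rw [indicator_of_mem hy, mul_assoc]
      · simp [hczero L hL hLx y hy]
    refine tendsto_integral_filter_of_dominated_convergence
      (fun y => ‖(Metric.closedBall 0 a.rOut).indicator (fun y => u y s₁) y‖ * (t - s₁)⁻¹)
      ?_ ?_ (hui'.norm.mul_const _) ?_
    · filter_upwards [hind, hsmall] with L hL hL'
      have hm : Continuous fun y => c L y * heatPow 1 (x - y) (t - s₁) :=
        (a.continuous.add ((contDiff_logCutoff hL'.1).continuous.sub continuous_const)).mul
          (contDiff_heatPow_sub 1 x (sub_pos.2 h1) (n := 0)).continuous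
      exact (hui'.aestronglyMeasurable.mul hm.aestronglyMeasurable).congr
        (ae_of_all _ fun y => (hL y).symm)
    · filter_upwards [hind] with L hL
      refine ae_of_all _ fun y => ?_
      rw [hL y, norm_mul]
      refine mul_le_mul_of_nonneg_left ?_ (norm_nonneg _)
      rw [norm_mul, norm_eq_abs, norm_eq_abs, abs_of_nonneg (heatPow_nonneg _ _ _)]
      refine (mul_le_mul_of_nonneg_right ?_ (heatPow_nonneg _ _ _)).trans
        ((one_mul _).trans_le (hPle y))
      rw [abs_le]
      constructor <;> simp only [hcdef] <;>
        linarith [a.nonneg (x := y), a.le_one (x := y), logCutoff_nonneg L y, logCutoff_le_one L y]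
    · have h0 : ∀ᵐ y : Plane ∂volume, y ≠ 0 := by
        simp [ae_iff]
      filter_upwards [h0] with y hy
      refine tendsto_const_nhds.congr' ?_
      filter_upwards [eventually_gt_atTop 0, tendsto_exp_neg_atTop_nhds_zero.eventually
        (gt_mem_nhds (norm_pos_iff.2 hy))] with L hL hLy
      simp [hcdef, logCutoff_eq_one hL hLy.le]
  have herr := tendsto_integral_mul_heatFlux_logCutoff h1 hgrow hx
  have htot := hlim.add (herr.const_add (∫ s in s₁..t, ∫ y, u y s * heatFlux a x t y s))
  rw [add_zero] at htot
  exact tendsto_nhds_unique (tendsto_const_nhds.congr' hident) htot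

end Punctured

/-! ### Parameter integrals and regularity of classical solutions. -/

/-- Smooth dependence on a parameter of an integral with a compactly supported smooth kernel. -/
lemma contDiffOn_integral_mul_of_compact_support {P G : Type*} [NormedAddCommGroup P]
    [NormedSpace ℝ P] [NormedAddCommGroup G] [NormedSpace ℝ G] [MeasurableSpace G] [BorelSpace G]
    {μ : Measure G} {f : G → ℝ} {g : P → G → ℝ} {n : ℕ∞} {s : Set P} {k : Set G} (hs : IsOpen s)
    (hk : IsCompact k) (hgs : ∀ p, ∀ y, p ∈ s → y ∉ k → g p y = 0) (hf : LocallyIntegrable f μ)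
    (hg : ContDiffOn ℝ n (fun q : P × G => g q.1 q.2) (s ×ˢ univ)) :
    ContDiffOn ℝ n (fun p => ∫ y, f y * g p y ∂μ) s := by
  -- The integral is a convolution with the reflected kernel `g p (-y)`, evaluated at the constant
  -- point `0`.
  have h := contDiffOn_convolution_right_with_param_comp (μ := μ) (ContinuousLinearMap.mul ℝ ℝ)
    (v := fun _ : P => (0 : G)) (f := f) (g := fun p y => g p (-y)) (k := -k) (n := n)
    contDiffOn_const hs hk.neg
    (fun p y hp hy => hgs p (-y) hp fun h => hy (by simpa using h)) hf
    (hg.comp (f := fun q : P × G => (q.1, -q.2))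
      (contDiff_fst.prodMk contDiff_snd.neg).contDiffOn fun q hq => ⟨hq.1, mem_univ _⟩)
  simpa [convolution_def] using h

section Regularity

variable {W : Plane × ℝ → ℝ}

lemma fderiv_slice (hW : ContDiff ℝ 2 W) (y : Plane) (s : ℝ) :
    fderiv ℝ (fun y => W (y, s)) y =
      (fderiv ℝ W (y, s)).comp (ContinuousLinearMap.inl ℝ Plane ℝ) := by
  have h1 := (hW.contDiffAt (x := (y, s))).differentiableAt (by simp)
  exact (h1.hasFDerivAt.comp y (hasFDerivAt_prodMk_left y s)).fderiv

lemma deriv_slice (hW : ContDiff ℝ 2 W) (y : Plane) (s : ℝ) :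
    deriv (fun s => W (y, s)) s = fderiv ℝ W (y, s) (0, 1) := by
  have h1 := (hW.contDiffAt (x := (y, s))).differentiableAt (by simp)
  have h2 := (h1.hasFDerivAt.comp s (hasFDerivAt_prodMk_right y s)).hasDerivAt.deriv
  simpa [Function.comp_def] using h2

lemma iteratedFDeriv_slice (hW : ContDiff ℝ 2 W) (y : Plane) (s : ℝ) :
    iteratedFDeriv ℝ 2 (fun y => W (y, s)) y =
      (iteratedFDeriv ℝ 2 W (y, s)).compContinuousLinearMap
        fun _ => ContinuousLinearMap.inl ℝ Plane ℝ := by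
  have h1 : ContDiff ℝ 2 fun z => W (z + (0, s)) := hW.comp (contDiff_id.add contDiff_const)
  have h2 := (ContinuousLinearMap.inl ℝ Plane ℝ).iteratedFDeriv_comp_right h1 y (i := 2) le_rfl
  rw [iteratedFDeriv_comp_add_right] at h2
  have h3 : ((fun z => W (z + (0, s))) ∘ ContinuousLinearMap.inl ℝ Plane ℝ) =
      fun y => W (y, s) := by
    funext y
    simp
  rw [h3] at h2
  simpa using h2

lemma continuous_iteratedFDeriv_slice (hW : ContDiff ℝ 2 W) :
    Continuous fun p : Plane × ℝ => iteratedFDeriv ℝ 2 (fun y => W (y, p.2)) p.1 := by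
  simp only [iteratedFDeriv_slice hW]
  exact (ContinuousMultilinearMap.compContinuousLinearMapL (F := ℝ)
    (fun _ : Fin 2 => ContinuousLinearMap.inl ℝ Plane ℝ)).continuous.comp
      (hW.continuous_iteratedFDeriv (m := 2) le_rfl)

lemma continuous_laplacian_slice (hW : ContDiff ℝ 2 W) :
    Continuous fun p : Plane × ℝ => Laplacian.laplacian (fun y => W (y, p.2)) p.1 := by
  simp only [InnerProductSpace.laplacian_eq_iteratedFDeriv_orthonormalBasis _
    (EuclideanSpace.basisFun (Fin 2) ℝ)]
  exact continuous_finsetSum _ fun i _ =>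
    (continuous_eval_const _).comp (continuous_iteratedFDeriv_slice hW)

lemma continuous_deriv_slice (hW : ContDiff ℝ 2 W) :
    Continuous fun p : Plane × ℝ => deriv (fun s => W (p.1, s)) p.2 := by
  simp only [deriv_slice hW]
  exact (hW.continuous_fderiv (by simp)).clm_apply continuous_const

/-- A function of class `C²` is a classical solution where it satisfies the heat equation. -/
lemma isClassicalHeatSolution_of_contDiff (hW : ContDiff ℝ 2 W) {D : Set (Plane × ℝ)}
    (h : ∀ p ∈ D, deriv (fun s => W (p.1, s)) p.2 =
      Laplacian.laplacian (fun y => W (y, p.2)) p.1) :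
    IsClassicalHeatSolution D fun y s => W (y, s) where
  contDiffAt_space p _ := (hW.comp (contDiff_id.prodMk contDiff_const)).contDiffAt
  differentiableAt_time p _ :=
    (hW.comp (contDiff_const.prodMk contDiff_id)).contDiffAt.differentiableAt (by simp)
  continuousOn := hW.continuous.continuousOn
  continuousOn_fderiv_space := by
    simp only [fderiv_slice hW]
    exact ((hW.continuous_fderiv (by simp)).clm_comp continuous_const).continuousOn
  continuousOn_iteratedFDeriv_space := (continuous_iteratedFDeriv_slice hW).continuousOn
  continuousOn_deriv_time := (continuous_deriv_slice hW).continuousOn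
  heat_eq := h

end Regularity

section Local

variable {n : ℕ} {D : Set (EuclideanSpace ℝ (Fin n) × ℝ)}
  {u v : EuclideanSpace ℝ (Fin n) → ℝ → ℝ}

lemma eventually_slice_space (hD : IsOpen D) {p : EuclideanSpace ℝ (Fin n) × ℝ} (hp : p ∈ D) :
    ∀ᶠ y in 𝓝 p.1, (y, p.2) ∈ D :=
  (Continuous.prodMk_left p.2).continuousAt.eventually (hD.mem_nhds hp)

lemma eventually_slice_time (hD : IsOpen D) {p : EuclideanSpace ℝ (Fin n) × ℝ} (hp : p ∈ D) :
    ∀ᶠ s in 𝓝 p.2, (p.1, s) ∈ D :=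
  (Continuous.prodMk_right p.1).continuousAt.eventually (hD.mem_nhds hp)

lemma IsClassicalHeatSolution.congr (hu : IsClassicalHeatSolution D u) (hD : IsOpen D)
    (h : ∀ p ∈ D, v p.1 p.2 = u p.1 p.2) : IsClassicalHeatSolution D v := by
  have hs : ∀ p ∈ D, (fun y => v y p.2) =ᶠ[𝓝 p.1] fun y => u y p.2 := fun p hp =>
    (eventually_slice_space hD hp).mono fun y hy => h _ hy
  have ht : ∀ p ∈ D, (fun s => v p.1 s) =ᶠ[𝓝 p.2] fun s => u p.1 s := fun p hp =>
    (eventually_slice_time hD hp).mono fun s hs => h _ hs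
  exact
  { contDiffAt_space := fun p hp => (hu.contDiffAt_space p hp).congr_of_eventuallyEq (hs p hp)
    differentiableAt_time := fun p hp =>
      (hu.differentiableAt_time p hp).congr_of_eventuallyEq (ht p hp)
    continuousOn := hu.continuousOn.congr h
    continuousOn_fderiv_space :=
      hu.continuousOn_fderiv_space.congr fun p hp => (hs p hp).fderiv_eq
    continuousOn_iteratedFDeriv_space := hu.continuousOn_iteratedFDeriv_space.congr
      fun p hp => ((hs p hp).iteratedFDeriv ℝ 2).eq_of_nhds
    continuousOn_deriv_time := hu.continuousOn_deriv_time.congr fun p hp => (ht p hp).deriv_eq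
    heat_eq := fun p hp => by
      rw [(ht p hp).deriv_eq, hu.heat_eq p hp,
        (InnerProductSpace.laplacian_congr_nhds (hs p hp)).eq_of_nhds] }

lemma IsClassicalHeatSolution.mono (hu : IsClassicalHeatSolution D u)
    {D' : Set (EuclideanSpace ℝ (Fin n) × ℝ)} (h : D' ⊆ D) : IsClassicalHeatSolution D' u where
  contDiffAt_space p hp := hu.contDiffAt_space p (h hp)
  differentiableAt_time p hp := hu.differentiableAt_time p (h hp)
  continuousOn := hu.continuousOn.mono h
  continuousOn_fderiv_space := hu.continuousOn_fderiv_space.mono h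
  continuousOn_iteratedFDeriv_space := hu.continuousOn_iteratedFDeriv_space.mono h
  continuousOn_deriv_time := hu.continuousOn_deriv_time.mono h
  heat_eq p hp := hu.heat_eq p (h hp)

/-- Being a classical solution is a local property. -/
lemma isClassicalHeatSolution_of_locally
    (h : ∀ p ∈ D, ∃ N, IsOpen N ∧ p ∈ N ∧ IsClassicalHeatSolution N u) :
    IsClassicalHeatSolution D u := by
  constructor
  · intro p hp
    obtain ⟨N, -, hpN, hN⟩ := h p hp
    exact hN.contDiffAt_space p hpN
  · intro p hp
    obtain ⟨N, -, hpN, hN⟩ := h p hp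
    exact hN.differentiableAt_time p hpN
  · intro p hp
    obtain ⟨N, hNo, hpN, hN⟩ := h p hp
    exact (hN.continuousOn.continuousAt (hNo.mem_nhds hpN)).continuousWithinAt
  · intro p hp
    obtain ⟨N, hNo, hpN, hN⟩ := h p hp
    exact (hN.continuousOn_fderiv_space.continuousAt (hNo.mem_nhds hpN)).continuousWithinAt
  · intro p hp
    obtain ⟨N, hNo, hpN, hN⟩ := h p hp
    exact (hN.continuousOn_iteratedFDeriv_space.continuousAt (hNo.mem_nhds hpN)).continuousWithinAt
  · intro p hp
    obtain ⟨N, hNo, hpN, hN⟩ := h p hp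
    exact (hN.continuousOn_deriv_time.continuousAt (hNo.mem_nhds hpN)).continuousWithinAt
  · intro p hp
    obtain ⟨N, -, hpN, hN⟩ := h p hp
    exact hN.heat_eq p hpN

end Local

/-- A `C²` function satisfying the heat equation off the time axis satisfies it on the axis. -/
lemma isClassicalHeatSolution_of_punctured {W : Plane × ℝ → ℝ} (hW : ContDiff ℝ 2 W)
    {N : Set (Plane × ℝ)} (hN : IsOpen N) {u : Plane → ℝ → ℝ}
    (hu : IsClassicalHeatSolution (N ∩ {p | p.1 ≠ 0}) u)
    (h : ∀ p ∈ N, p.1 ≠ 0 → u p.1 p.2 = W p) :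
    IsClassicalHeatSolution N fun y s => W (y, s) := by
  have hN' : IsOpen (N ∩ {p : Plane × ℝ | p.1 ≠ 0}) :=
    hN.inter (isOpen_ne.preimage continuous_fst)
  have hWu := hu.congr (v := fun y s => W (y, s)) hN' fun p hp => (h p hp.1 hp.2).symm
  refine isClassicalHeatSolution_of_contDiff hW fun p hp => ?_
  by_cases hp0 : p.1 = 0
  · have hev : ∀ᶠ y in 𝓝[≠] p.1, deriv (fun s => W (y, s)) p.2 =
        Laplacian.laplacian (fun y => W (y, p.2)) y := by
      filter_upwards [nhdsWithin_le_nhds (eventually_slice_space hN hp), self_mem_nhdsWithin]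
        with y hy hy0
      exact hWu.heat_eq (y, p.2) ⟨hy, fun h' => hy0 (by simpa [hp0] using h')⟩
    have c : Continuous fun y : Plane => (y, p.2) := by fun_prop
    exact tendsto_nhds_unique_of_eventuallyEq
      ((((continuous_deriv_slice hW).comp c).tendsto p.1).mono_left nhdsWithin_le_nhds)
      ((((continuous_laplacian_slice hW).comp c).tendsto p.1).mono_left nhdsWithin_le_nhds) hev
  · exact hWu.heat_eq p ⟨hp, hp0⟩

/-! ### Smooth extension across the time axis. -/

lemma contDiff_laplacian {c : Plane → ℝ} {n : ℕ∞} (hc : ContDiff ℝ ∞ c) :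
    ContDiff ℝ n (Laplacian.laplacian c) := by
  have h2 : ContDiff ℝ n (fderiv ℝ (fderiv ℝ c)) :=
    ((hc.fderiv_right (m := ∞) (by simp)).fderiv_right (m := ∞) (by simp)).of_le (by
      exact_mod_cast le_top)
  have : Laplacian.laplacian c = fun x =>
      ∑ i, fderiv ℝ (fderiv ℝ c) x (EuclideanSpace.basisFun (Fin 2) ℝ i)
      (EuclideanSpace.basisFun (Fin 2) ℝ i) := funext (laplacian_eq_sum_fderiv_fderiv c)
  rw [this]
  exact ContDiff.sum fun i _ => (h2.clm_apply contDiff_const).clm_apply contDiff_const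

lemma contDiffAt_heatPow_sub (k : ℕ) {n : ℕ∞} {x y : Plane} {t s : ℝ} (h : x ≠ y ∨ s < t) :
    ContDiffAt ℝ n (fun q : (Plane × ℝ) × (ℝ × Plane) => heatPow k (q.1.1 - q.2.2) (q.1.2 - q.2.1))
      ((x, t), (s, y)) := by
  have h1 : ContDiffAt ℝ n (fun q : Plane × ℝ => heatPow k q.1 q.2) (x - y, t - s) :=
    contDiffAt_heatPow k (h.imp sub_ne_zero.2 sub_pos.2)
  exact ContDiffAt.comp (f := fun q : (Plane × ℝ) × (ℝ × Plane) => (q.1.1 - q.2.2, q.1.2 - q.2.1))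
    ((x, t), (s, y)) h1 (by fun_prop)

/-- Smoothness is joint in the pole and the integration point, as differentiation under the integral
requires. No order between `s` and `t` is needed: off `x = y` the kernel is smooth in time, and
elsewhere the flux vanishes locally. -/
lemma contDiffAt_heatFlux {c : Plane → ℝ} (hc : ContDiff ℝ ∞ c) {n : ℕ∞} {x y : Plane} {t s : ℝ}
    (h : x ≠ y ∨ ∃ b, c =ᶠ[𝓝 y] fun _ => b) :
    ContDiffAt ℝ n (fun q : (Plane × ℝ) × (ℝ × Plane) => heatFlux c q.1.1 q.1.2 q.2.2 q.2.1)
      ((x, t), (s, y)) := by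
  rcases h with h | ⟨b, hb⟩
  · unfold heatFlux
    have h1 : ContDiff ℝ n (fderiv ℝ c) :=
      (hc.fderiv_right (m := ∞) (by simp)).of_le (by exact_mod_cast le_top)
    have h2 : ContDiff ℝ n fun q : (Plane × ℝ) × (ℝ × Plane) => fderiv ℝ c q.2.2 (q.1.1 - q.2.2) :=
      (h1.comp (contDiff_snd.comp contDiff_snd)).clm_apply (by fun_prop)
    have h3 : ContDiff ℝ n fun q : (Plane × ℝ) × (ℝ × Plane) => Laplacian.laplacian c q.2.2 :=
      (contDiff_laplacian hc).comp (contDiff_snd.comp contDiff_snd)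
    exact (h2.contDiffAt.mul (contDiffAt_heatPow_sub 2 (Or.inl h))).add
      (h3.contDiffAt.mul (contDiffAt_heatPow_sub 1 (Or.inl h)))
  · have h' : ∀ᶠ z in 𝓝 y, c =ᶠ[𝓝 z] fun _ => b := hb.eventually_nhds
    have hcont : ContinuousAt (fun q : (Plane × ℝ) × (ℝ × Plane) => q.2.2) ((x, t), (s, y)) := by
      fun_prop
    refine (contDiffAt_const (c := (0 : ℝ))).congr_of_eventuallyEq ?_
    filter_upwards [hcont.eventually h'] with q hq
    exact heatFlux_eq_zero_of_eventuallyEq hq _ _ _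

section Extension

variable {Ω : Set Plane} {I : Set ℝ} {u : Plane → ℝ → ℝ}

/-- Smooth extension across the singularity. -/
lemma exists_contDiffOn_extension (hΩ : IsOpen Ω) (hIo : IsOpen I)
    (hu : IsClassicalHeatSolution ((Ω \ {0}) ×ˢ I) u) (a : ContDiffBump (0 : Plane))
    (ha : Metric.closedBall 0 a.rOut ⊆ Ω) {s₁ s₂ : ℝ} (h12 : s₁ < s₂) (hI : Icc s₁ s₂ ⊆ I)
    (hgrow : ∀ δ : ℝ, 0 < δ → ∃ R₀ : ℝ, 0 < R₀ ∧ ∀ y : Plane, 0 < ‖y‖ → ‖y‖ ≤ R₀ →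
      ∀ s ∈ Icc s₁ s₂, |u y s| ≤ δ * log (1 / ‖y‖)) :
    ∃ w : Plane × ℝ → ℝ, ContDiffOn ℝ 2 w (Metric.ball 0 a.rIn ×ˢ Ioo s₁ s₂) ∧
      ∀ p ∈ Metric.ball (0 : Plane) a.rIn ×ˢ Ioo s₁ s₂, p.1 ≠ 0 → u p.1 p.2 = w p := by
  set S : Set (Plane × ℝ) := Metric.ball 0 a.rIn ×ˢ Ioo s₁ s₂ with hS
  have hSo : IsOpen S := Metric.isOpen_ball.prod isOpen_Ioo
  set K : Set Plane := Metric.closedBall 0 a.rOut \ Metric.ball 0 a.rIn with hK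
  have hKc : IsCompact K := (isCompact_closedBall _ _).diff Metric.isOpen_ball
  have hac : ContDiff ℝ ∞ a := a.contDiff (n := (⊤ : ℕ∞))
  have hKΩ : K ⊆ Ω \ {0} := fun y hy => ⟨ha hy.1, by
    rintro rfl
    exact hy.2 (Metric.mem_ball_self a.rIn_pos)⟩
  have haK : ∀ y ∉ K, ∃ b, (a : Plane → ℝ) =ᶠ[𝓝 y] fun _ => b := fun y hy => by
    by_cases h : y ∈ Metric.ball 0 a.rIn
    · exact ⟨1, a.eventuallyEq_one_of_mem_ball h⟩
    · refine ⟨0, notMem_tsupport_iff_eventuallyEq.1 fun h' => hy ⟨?_, h⟩⟩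
      rwa [a.tsupport_eq] at h'
  -- The time cutoff `b` gives the flux kernel compact support in time without changing the integral
  -- over `[s₁, s₂]`.
  obtain ⟨b, hb1⟩ : ∃ b : ContDiffBump ((s₁ + s₂) / 2), ∀ s ∈ Icc s₁ s₂, b s = 1 := by
    refine ⟨⟨s₂ - s₁, 2 * (s₂ - s₁), sub_pos.2 h12, by linarith⟩, fun s hs => ?_⟩
    apply ContDiffBump.one_of_mem_closedBall
    rw [Metric.mem_closedBall, Real.dist_eq, abs_le]
    constructor <;> linarith [hs.1, hs.2]
  have hs₁ : s₁ ∈ Icc s₁ s₂ := ⟨le_rfl, h12.le⟩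
  have hui : Integrable ((Metric.closedBall 0 a.rOut).indicator fun y => u y s₁) := by
    rw [integrable_indicator_iff measurableSet_closedBall]
    obtain ⟨R₀, hR₀, hb⟩ := hgrow 1 one_pos
    exact integrableOn_of_le_log (hu.contDiffOn_slice (hI hs₁)).continuousOn ha hR₀
      fun y hy hy' => by simpa using hb y hy hy' s₁ hs₁
  have hw₁ : ContDiffOn ℝ (2 : ℕ∞) (fun p : Plane × ℝ => ∫ y,
      (Metric.closedBall 0 a.rOut).indicator (fun y => u y s₁) y *
        (a y * heatPow 1 (p.1 - y) (p.2 - s₁))) S := by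
    refine contDiffOn_integral_mul_of_compact_support hSo a.hasCompactSupport
      (g := fun p y => a y * heatPow 1 (p.1 - y) (p.2 - s₁))
      (fun p y _ hy => by simp [image_eq_zero_of_notMem_tsupport hy]) hui.locallyIntegrable ?_
    rintro ⟨⟨x, t⟩, y⟩ ⟨hp, -⟩
    have h1 : ContDiffAt ℝ (2 : ℕ∞) (fun q : Plane × ℝ => heatPow 1 q.1 q.2) (x - y, t - s₁) :=
      contDiffAt_heatPow 1 (Or.inr (sub_pos.2 hp.2.1))
    have h2 : ContDiffAt ℝ (2 : ℕ∞) (fun q : (Plane × ℝ) × Plane =>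
        heatPow 1 (q.1.1 - q.2) (q.1.2 - s₁)) ((x, t), y) :=
      ContDiffAt.comp (f := fun q : (Plane × ℝ) × Plane => (q.1.1 - q.2, q.1.2 - s₁))
        ((x, t), y) h1 (by fun_prop)
    have h3 : ContDiff ℝ (2 : ℕ∞) fun q : (Plane × ℝ) × Plane => a q.2 :=
      (a.contDiff (n := (2 : ℕ∞))).comp contDiff_snd
    exact (h3.contDiffAt.mul h2).contDiffWithinAt
  have hf₂ : IntegrableOn (fun q : ℝ × Plane => u q.2 q.1) (Icc s₁ s₂ ×ˢ K) := by
    refine ContinuousOn.integrableOn_compact (isCompact_Icc.prod hKc) ?_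
    exact hu.continuousOn.comp continuous_swap.continuousOn fun q hq => ⟨hKΩ hq.2, hI hq.1⟩
  have hf₂' := (integrable_indicator_iff (measurableSet_Icc.prod hKc.measurableSet)).2 hf₂
  have hw₂ : ContDiffOn ℝ (2 : ℕ∞) (fun p : Plane × ℝ => ∫ q : ℝ × Plane,
      (Icc s₁ s₂ ×ˢ K).indicator (fun q : ℝ × Plane => u q.2 q.1) q *
        (b q.1 * heatFlux a p.1 p.2 q.2 q.1)) S := by
    refine contDiffOn_integral_mul_of_compact_support hSo (b.hasCompactSupport.prod hKc)
      (g := fun p q => b q.1 * heatFlux a p.1 p.2 q.2 q.1) ?_ hf₂'.locallyIntegrable ?_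
    · intro p q _ hq
      by_cases h1 : q.1 ∈ tsupport b
      · obtain ⟨e, he⟩ := haK q.2 fun h2 => hq ⟨h1, h2⟩
        simp [heatFlux_eq_zero_of_eventuallyEq he]
      · simp [image_eq_zero_of_notMem_tsupport h1]
    · rintro ⟨⟨x, t⟩, ⟨s, y⟩⟩ ⟨hp, -⟩
      have h3 : ContDiff ℝ (2 : ℕ∞) fun q : (Plane × ℝ) × (ℝ × Plane) => b q.2.1 :=
        (b.contDiff (n := (2 : ℕ∞))).comp (contDiff_fst.comp contDiff_snd)
      refine (h3.contDiffAt.mul (contDiffAt_heatFlux hac ?_)).contDiffWithinAt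
      -- The pole lies in the open ball of radius `a.rIn` and `K` outside it, so the two never meet.
      by_cases hy : y ∈ K
      · refine Or.inl ?_
        rintro rfl
        exact hy.2 hp.1
      · exact Or.inr (haK y hy)
  refine ⟨_, (contDiffOn_const (c := (4 * π)⁻¹)).mul (hw₁.add hw₂), ?_⟩
  rintro ⟨x, t⟩ ⟨hx, ht⟩ hx0
  rw [mem_ball_zero_iff] at hx
  have hIt : Icc s₁ t ⊆ Icc s₁ s₂ := Icc_subset_Icc_right ht.2.le
  have hrep := punctured_heat_representation hΩ hIo hu a ha ht.1 (hIt.trans hI) (fun δ hδ => by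
    obtain ⟨R₀, hR₀, h⟩ := hgrow δ hδ
    exact ⟨R₀, hR₀, fun y hy hy' s hs => h y hy hy' s (hIt hs)⟩) hx0 hx
  have e1 : ∀ y, (Metric.closedBall 0 a.rOut).indicator (fun y => u y s₁) y *
      (a y * heatPow 1 (x - y) (t - s₁)) = u y s₁ * a y * heatPow 1 (x - y) (t - s₁) := by
    intro y
    by_cases hy : y ∈ Metric.closedBall 0 a.rOut
    · rw [indicator_of_mem hy, mul_assoc]
    · rw [← a.tsupport_eq] at hy
      simp [image_eq_zero_of_notMem_tsupport hy]
  have hint := integrable_mul_heatFlux hu (a.contDiff (n := 2)) hKc hKΩ haK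
    (a.eventuallyEq_one_of_mem_ball (mem_ball_zero_iff.2 hx)) t (hIt.trans hI)
  -- The moving upper limit `t` may be replaced by the fixed `s₂`, because the kernel vanishes for
  -- `s ≥ t`. Smoothness in `t` then comes from the integrand alone.
  have e2 : ∫ q : ℝ × Plane, (Icc s₁ s₂ ×ˢ K).indicator (fun q : ℝ × Plane => u q.2 q.1) q *
      (b q.1 * heatFlux a x t q.2 q.1) = ∫ s in s₁..t, ∫ y, u y s * heatFlux a x t y s := by
    rw [intervalIntegral.integral_of_le ht.1.le, ← integral_Icc_eq_integral_Ioc,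
      ← integral_prod _ hint]
    have hm : (volume.restrict (Icc s₁ t)).prod (volume : Measure Plane) =
        (volume.prod volume).restrict (Icc s₁ t ×ˢ univ) := by
      rw [← Measure.prod_restrict, Measure.restrict_univ]
    rw [hm, ← integral_indicator (measurableSet_Icc.prod MeasurableSet.univ)]
    refine integral_congr_ae (ae_of_all _ ?_)
    rintro ⟨s, y⟩
    simp only
    by_cases hs : s ∈ Icc s₁ t
    · rw [indicator_of_mem (show (s, y) ∈ Icc s₁ t ×ˢ univ from ⟨hs, mem_univ y⟩), hb1 s (hIt hs),
        one_mul]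
      by_cases hy : y ∈ K
      · rw [indicator_of_mem (show (s, y) ∈ Icc s₁ s₂ ×ˢ K from ⟨hIt hs, hy⟩)]
      · obtain ⟨e, he⟩ := haK y hy
        simp [heatFlux_eq_zero_of_eventuallyEq he]
    · rw [indicator_of_notMem (show (s, y) ∉ Icc s₁ t ×ˢ univ from fun h => hs h.1)]
      by_cases hs' : s ∈ Icc s₁ s₂
      · have hts : t - s ≤ 0 := by
          by_contra h
          exact hs ⟨hs'.1, by linarith⟩
        simp [heatFlux, heatPow_of_nonpos _ _ hts]
      · rw [indicator_of_notMem (show (s, y) ∉ Icc s₁ s₂ ×ˢ K from fun h => hs' h.1), zero_mul]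
  simp only [e1, e2]
  rw [← hrep]
  field_simp

/-- A smooth function on an open set agrees near each point with a globally smooth one. -/
lemma exists_contDiff_eq_near {w : Plane × ℝ → ℝ} {S : Set (Plane × ℝ)} (hS : IsOpen S)
    (hw : ContDiffOn ℝ 2 w S) {p : Plane × ℝ} (hp : p ∈ S) :
    ∃ W : Plane × ℝ → ℝ, ContDiff ℝ 2 W ∧ ∃ N ⊆ S, IsOpen N ∧ p ∈ N ∧ ∀ q ∈ N, w q = W q := by
  obtain ⟨r, hr, hrS⟩ := Metric.isOpen_iff.1 hS p hp
  let β : ContDiffBump p := ⟨r / 4, r / 2, by positivity, by linarith⟩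
  have hβ : tsupport β ⊆ S := by
    rw [β.tsupport_eq]
    exact (Metric.closedBall_subset_ball (show r / 2 < r by linarith)).trans hrS
  refine ⟨fun q => β q * w q, ?_, Metric.ball p (r / 4),
    (Metric.ball_subset_ball (by linarith)).trans hrS, Metric.isOpen_ball,
    Metric.mem_ball_self (by positivity), fun q hq => ?_⟩
  · rw [contDiff_iff_contDiffAt]
    intro q
    by_cases hq : q ∈ tsupport β
    · exact (β.contDiff (n := 2)).contDiffAt.mul (hw.contDiffAt (hS.mem_nhds (hβ hq)))
    · refine (contDiffAt_const (c := (0 : ℝ))).congr_of_eventuallyEq ?_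
      filter_upwards [notMem_tsupport_iff_eventuallyEq.1 hq] with z hz
      simp [hz]
  · simp only [β.one_of_mem_closedBall (Metric.ball_subset_closedBall hq), one_mul]

end Extension

/-! ### The equivalence and the example `log |x|`. -/

lemma isOpen_timeInterval (T : EReal) : IsOpen (timeInterval T) :=
  (isOpen_lt continuous_const continuous_id).inter
    (isOpen_lt continuous_coe_real_ereal continuous_const)

lemma Icc_subset_timeInterval {T : EReal} {t₁ t₂ : ℝ} (h1 : 0 < t₁) (h2 : (t₂ : EReal) < T) :
    Icc t₁ t₂ ⊆ timeInterval T := fun _ ht =>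
  ⟨h1.trans_le ht.1, (EReal.coe_le_coe_iff.2 ht.2).trans_lt h2⟩

section Main

variable {Ω : Set Plane} {T : EReal} {u : Plane → ℝ → ℝ}

/-- The extension is bounded by some `M` on a compact cylinder, and `δ log (1 / |x|) ≥ M` once `|x|
≤ exp (-M / δ)`. -/
lemma HasRemovableSingularities.logGrowthCondition (hΩ : IsOpen Ω) (h0 : (0 : Plane) ∈ Ω)
    (h : HasRemovableSingularities Ω T u) : LogGrowthCondition Ω T u := by
  obtain ⟨v, hv, huv⟩ := h
  intro t₁ t₂ ht₁ _ ht₂ δ hδ _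
  obtain ⟨R, hR, hRΩ⟩ := Metric.nhds_basis_closedBall.mem_iff.1 (hΩ.mem_nhds h0)
  have hI := Icc_subset_timeInterval ht₁ ht₂
  obtain ⟨M, hM⟩ := ((isCompact_closedBall (0 : Plane) R).prod
    isCompact_Icc).exists_bound_of_continuousOn (hv.continuousOn.mono (prod_mono hRΩ hI))
  refine ⟨min R (exp (-(M / δ))), lt_min hR (exp_pos _),
    (Metric.closedBall_subset_closedBall (min_le_left _ _)).trans hRΩ, fun x hx hxR t h1 h2 => ?_⟩
  have hxR' : x ∈ Metric.closedBall (0 : Plane) R :=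
    mem_closedBall_zero_iff.2 (hxR.trans (min_le_left _ _))
  rw [huv x ⟨hRΩ hxR', norm_pos_iff.1 hx⟩ t (hI ⟨h1, h2⟩)]
  refine (hM (x, t) ⟨hxR', h1, h2⟩).trans ?_
  have hl : log ‖x‖ ≤ -(M / δ) := (log_le_iff_le_exp hx).2 (hxR.trans (min_le_right _ _))
  rw [one_div, log_inv]
  calc M = δ * (M / δ) := by field_simp
    _ ≤ δ * -log ‖x‖ := mul_le_mul_of_nonneg_left (by linarith) hδ.le

lemma LogGrowthCondition.exists_extension_near (hΩ : IsOpen Ω) (h0 : (0 : Plane) ∈ Ω)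
    (hu : IsClassicalHeatSolution ((Ω \ {0}) ×ˢ timeInterval T) u)
    (h : LogGrowthCondition Ω T u) {t : ℝ} (ht : t ∈ timeInterval T) :
    ∃ W : Plane × ℝ → ℝ, ContDiff ℝ 2 W ∧ ∃ N ⊆ Ω ×ˢ timeInterval T, IsOpen N ∧
      ((0 : Plane), t) ∈ N ∧ ∀ p ∈ N, p.1 ≠ 0 → u p.1 p.2 = W p := by
  obtain ⟨s₂, hts₂, hs₂⟩ := EReal.lt_iff_exists_real_btwn.1 ht.2
  rw [EReal.coe_lt_coe_iff] at hts₂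
  have ht0 : 0 < t := ht.1
  obtain ⟨R, hR, hRΩ⟩ := Metric.nhds_basis_closedBall.mem_iff.1 (hΩ.mem_nhds h0)
  let a : ContDiffBump (0 : Plane) := ⟨R / 2, R, by positivity, by linarith⟩
  have hI := Icc_subset_timeInterval (half_pos ht0) hs₂
  have hlt : t / 2 < s₂ := by linarith
  obtain ⟨w, hw, huw⟩ := exists_contDiffOn_extension hΩ (isOpen_timeInterval T) hu a hRΩ hlt hI
    (fun δ hδ => by
      -- The growth condition covers only `δ < 1`. Capping `δ` at `1/2` and the radius at `1`, where
      -- the logarithm is nonnegative, yields the bound for every `δ > 0`.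
      have hδ' : 0 < min δ (1 / 2) := lt_min hδ (by norm_num)
      obtain ⟨R₀, hR₀, -, hb⟩ := h (t / 2) s₂ (half_pos ht0) hlt hs₂ (min δ (1 / 2)) hδ'
        ((min_le_right _ _).trans_lt (by norm_num))
      refine ⟨min R₀ 1, lt_min hR₀ one_pos, fun y hy hy' s hs => ?_⟩
      refine (hb y hy (hy'.trans (min_le_left _ _)) s hs.1 hs.2).trans ?_
      refine mul_le_mul_of_nonneg_right (min_le_left _ _) (log_nonneg ?_)
      rw [le_div_iff₀ hy, one_mul]
      exact hy'.trans (min_le_right _ _))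
  have hSo : IsOpen (Metric.ball (0 : Plane) a.rIn ×ˢ Ioo (t / 2) s₂) :=
    Metric.isOpen_ball.prod isOpen_Ioo
  obtain ⟨W, hW, N, hNS, hN, htN, hwW⟩ := exists_contDiff_eq_near hSo hw
    (p := (0, t)) ⟨Metric.mem_ball_self a.rIn_pos, by linarith, hts₂⟩
  refine ⟨W, hW, N, hNS.trans (prod_mono ?_ (Ioo_subset_Icc_self.trans hI)), hN, htN,
    fun p hp hp0 => (huw p (hNS hp) hp0).trans (hwW p hp)⟩
  exact (Metric.ball_subset_closedBall.trans
    (Metric.closedBall_subset_closedBall a.rIn_lt_rOut.le)).trans hRΩ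

lemma LogGrowthCondition.hasRemovableSingularities (hΩ : IsOpen Ω) (h0 : (0 : Plane) ∈ Ω)
    (hu : IsClassicalHeatSolution ((Ω \ {0}) ×ˢ timeInterval T) u)
    (h : LogGrowthCondition Ω T u) : HasRemovableSingularities Ω T u := by
  classical
  -- The local extensions depend on the chosen time. Defining `v` on the axis by the limit of `u`
  -- makes it agree with each of them, so no compatibility has to be checked.
  set v : Plane → ℝ → ℝ := fun x t => if x = 0 then limUnder (𝓝[≠] (0 : Plane)) fun y => u y t
    else u x t with hv
  have hvu : ∀ x ≠ 0, ∀ t, v x t = u x t := fun x hx t => if_neg hx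
  refine ⟨v, isClassicalHeatSolution_of_locally ?_, fun x hx t _ => (hvu x hx.2 t).symm⟩
  rintro ⟨x, t⟩ ⟨hx, ht⟩
  by_cases hx0 : x = 0
  · subst hx0
    obtain ⟨W, hW, N, hNsub, hN, htN, huW⟩ := h.exists_extension_near hΩ h0 hu ht
    refine ⟨N, hN, htN, IsClassicalHeatSolution.congr (u := fun y s => W (y, s)) ?_ hN ?_⟩
    · refine isClassicalHeatSolution_of_punctured hW hN (hu.mono ?_) huW
      exact fun p hp => ⟨⟨(hNsub hp.1).1, hp.2⟩, (hNsub hp.1).2⟩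
    · rintro ⟨y, s⟩ hys
      by_cases hy : y = 0
      · subst hy
        simp only [hv, if_pos]
        apply Tendsto.limUnder_eq
        have hWc : Tendsto (fun y : Plane => W (y, s)) (𝓝[≠] 0) (𝓝 (W (0, s))) := by
          have : Continuous fun y : Plane => W (y, s) := hW.continuous.comp (by fun_prop)
          exact (this.tendsto 0).mono_left nhdsWithin_le_nhds
        refine hWc.congr' ?_
        filter_upwards [nhdsWithin_le_nhds (eventually_slice_space hN hys), self_mem_nhdsWithin]
          with y hy hy0
        exact (huW (y, s) hy hy0).symm
      · rw [hvu y hy]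
        exact huW (y, s) hys hy
  · have hD : IsOpen ((Ω \ {0}) ×ˢ timeInterval T) :=
      (hΩ.sdiff isClosed_singleton).prod (isOpen_timeInterval T)
    exact ⟨_, hD, ⟨⟨hx, hx0⟩, ht⟩, hu.congr hD fun p hp => hvu p.1 hp.1.2 p.2⟩

lemma isClassicalHeatSolution_log_norm (Ω : Set Plane) (T : EReal) :
    IsClassicalHeatSolution ((Ω \ {0}) ×ˢ timeInterval T) fun x _ => log ‖x‖ := by
  have hlog : (fun x : Plane => log ‖x‖) = fun x => log (‖x - 0‖ ^ 2) / 2 := by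
    funext x
    rw [log_norm_sub_zero_sq]
    ring
  have hc : ∀ x : Plane, x ≠ 0 → ContDiffAt ℝ 2 (fun x : Plane => log ‖x‖) x := fun x hx =>
    (contDiffAt_norm ℝ hx).log (norm_ne_zero_iff.2 hx)
  have hne : ∀ p ∈ (Ω \ {0}) ×ˢ timeInterval T, p.1 ≠ (0 : Plane) := fun p hp => hp.1.2
  refine ⟨fun p hp => hc p.1 (hne p hp), fun p _ => differentiableAt_const _, fun p hp => ?_,
    fun p hp => ?_, fun p hp => ?_, ?_, fun p hp => ?_⟩
  · have h := (hc p.1 (hne p hp)).continuousAt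
    exact (h.comp (f := Prod.fst) continuousAt_fst).continuousWithinAt
  · have h := ((hc p.1 (hne p hp)).fderiv_right (m := 1) (by norm_num)).continuousAt
    exact (ContinuousAt.comp (f := Prod.fst) h continuousAt_fst).continuousWithinAt
  · have h := ((hc p.1 (hne p hp)).iteratedFDeriv_right (m := 0) (i := 2) (by norm_num)).continuousAt
    exact (ContinuousAt.comp (f := Prod.fst) h continuousAt_fst).continuousWithinAt
  · simp only [deriv_const]
    exact continuousOn_const
  · have hp0 : 0 < ‖p.1 - 0‖ ^ 2 := by
      have := norm_pos_iff.2 (hne p hp)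
      rw [sub_zero]
      positivity
    have h1 : ∀ᶠ r in 𝓝 (‖p.1 - 0‖ ^ 2), HasDerivAt (fun r => log r / 2) (r⁻¹ / 2) r := by
      filter_upwards [lt_mem_nhds hp0] with r hr using (hasDerivAt_log (ne_of_gt hr)).div_const 2
    simp only [deriv_const, hlog]
    rw [laplacian_comp_norm_sub_sq h1 ((hasDerivAt_inv hp0.ne').div_const 2)]
    field_simp
    ring

/-- With `δ = 1/2` the condition would give `|log |x|| ≤ |log |x|| / 2` at a point with `0 < |x| <
1`. -/
lemma not_logGrowthCondition_log_norm (hT : 0 < T) :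
    ¬ LogGrowthCondition Ω T fun x _ => log ‖x‖ := by
  intro h
  obtain ⟨t₂, h2, h2T⟩ := EReal.lt_iff_exists_real_btwn.1 hT
  have h2' : 0 < t₂ := by exact_mod_cast h2
  obtain ⟨R₀, hR₀, -, hb⟩ := h (t₂ / 2) t₂ (half_pos h2') (by linarith) h2T (1 / 2) (by norm_num)
    (by norm_num)
  have hr : 0 < min R₀ (1 / 2) := lt_min hR₀ (by norm_num)
  obtain ⟨x, hx⟩ := exists_norm_eq Plane hr.le
  have := hb x (hx ▸ hr) (hx ▸ min_le_left _ _) t₂ (by linarith) le_rfl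
  have hneg : log ‖x‖ < 0 := log_neg (hx ▸ hr) (by
    rw [hx]
    exact (min_le_right _ _).trans_lt (by norm_num))
  simp only [one_div ‖x‖, log_inv, abs_of_neg hneg] at this
  linarith

end Main

theorem theorem2 (Ω : Set (EuclideanSpace ℝ (Fin 2))) (hΩ_open : IsOpen Ω)
    (hΩ_conn : IsConnected Ω) (h0 : (0 : EuclideanSpace ℝ (Fin 2)) ∈ Ω)
    (T : EReal) (hT : 0 < T) :
    (∀ u : EuclideanSpace ℝ (Fin 2) → ℝ → ℝ,
      IsClassicalHeatSolution ((Ω \ {0}) ×ˢ timeInterval T) u →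
        (HasRemovableSingularities Ω T u ↔ LogGrowthCondition Ω T u)) ∧
    (IsClassicalHeatSolution ((Ω \ {0}) ×ˢ timeInterval T) (fun x _ => Real.log ‖x‖) ∧
      ¬ HasRemovableSingularities Ω T (fun x _ => Real.log ‖x‖) ∧
      ¬ LogGrowthCondition Ω T (fun x _ => Real.log ‖x‖)) :=
  ⟨fun _ hu => ⟨fun h => h.logGrowthCondition hΩ_open h0,
      fun h => h.hasRemovableSingularities hΩ_open h0 hu⟩,
    isClassicalHeatSolution_log_norm Ω T,
    fun h => not_logGrowthCondition_log_norm hT (h.logGrowthCondition hΩ_open h0),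
    not_logGrowthCondition_log_norm hT⟩
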